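/- Let $\mathbb{K}\in\{\mathbb{R},\mathbb{C}\}$. A unital locally convex algebra is a unital associative $\mathbb{K}$-algebra with a Hausdorff locally convex vector space topology for which the multiplication is jointly continuous; it is a unital Fréchet algebra if it is moreover metrizable and complete. Manifolds are smooth, finite-dimensional, Hausdorff, second countable and without boundary. For a manifold $N$ and a locally convex space $E$, $C^{\infty}(N,E)$ is the space of smooth functions $N\to E$ with the smooth compact open topology, i.e. the topology of uniform convergence on compact subsets of charts of all iterated directional derivatives. If $B$ is a unital locally convex algebra, then so is $C^\infty(N,B)$ with the pointwise operations, and for $a\in B$ the smooth localization of $B$ with respect to $a$ is the quotient locally convex algebra $$B_{\{a\}}:=C^{\infty}(\mathbb{R},B)/I_a,\qquad I_a:=\overline{\langle\, t\mapsto 1_B-ta\,\rangle},$$ where $I_a$ is the closure of the two-sided ideal generated by the function $t\mapsto 1_B-ta$. **Corollary.** Let $A$ be a unital Fréchet algebra and $M$ a manifold. (1) Let $f:M\to\mathbb{R}$ be smooth and $M_f:=\{m\in M: f(m)\neq 0\}$. Write $C^\infty(M,A)_{\{f\}}$ for the smooth localization of $C^\infty(M,A)$ with respect to the function $m\mapsto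 f(m)1_A$. Then $C^\infty(M,A)_{\{f\}}$ and $C^\infty(M_f,A)$ are unital Fréchet algebras, and the map $$\phi_f:C^\infty(M,A)_{\{f\}}\to C^\infty(M_f,A),\qquad \phi_f([F])(m)=F\Big(\frac{1}{f(m)}\Big)(m)\quad (m\in M_f),$$ is well defined and an isomorphism of unital Fréchet algebras, i.e. an isomorphism of unital $\mathbb{K}$-algebras and a homeomorphism. (2) For every open subset $U\subseteq M$ there is a smooth function $f:M\to\mathbb{R}$ with $M_f=U$; the algebra $C^\infty(U,A)$ is a unital Fréchet algebra, and for every smooth $f$ with $M_f=U$, the map $[F]\mapsto \big(m\mapsto F(1/f(m))(m)\big)$ is an isomorphism of unital Fréchet algebras $C^\infty(M,A)_{\{f\}}\to C^\infty(U,A)$. -/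

import Mathlib

open Set Filter Topology Manifold
open scoped ContDiff

/-! ### Locally convex algebras and Fréchet algebras -/

/-- A (Hausdorff) unital locally convex algebra: an associative unital real algebra with a Hausdorff
locally convex vector space topology for which the multiplication is jointly continuous. -/
class LocallyConvexAlgebra (A : Type*) [Ring A] [Algebra ℝ A] [TopologicalSpace A] : Prop extends
  IsTopologicalRing A, ContinuousSMul ℝ A, LocallyConvexSpace ℝ A, T2Space A

/-- A unital Fréchet algebra: a unital locally convex algebra which is metrizable and complete
(for the uniform structure of its additive group). -/
class FrechetAlgebra (A : Type*) [Ring A] [Algebra ℝ A] [TopologicalSpace A] : Prop extends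
    LocallyConvexAlgebra A where
  metrizable : TopologicalSpace.MetrizableSpace A
  complete : @CompleteSpace A (IsTopologicalAddGroup.rightUniformSpace A)

/-! ### Smooth functions on an open set of a finite-dimensional vector space -/

section Calculus

set_option linter.unusedSectionVars false

variable {V : Type*} [NormedAddCommGroup V] [NormedSpace ℝ V]
variable {E : Type*} [AddCommGroup E] [Module ℝ E] [TopologicalSpace E]

/-- The difference quotient `t ↦ (f (x + t v) - f x) / t`. -/
noncomputable def diffQuot (f : V → E) (v x : V) (t : ℝ) : E := t⁻¹ • (f (x + t • v) - f x)

/-- The directional derivative `x ↦ df(x)(v)`, the limit of the difference quotients (a junk value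
where the limit does not exist; `SmoothOn` below requires that it exists). -/
noncomputable def dirDeriv (f : V → E) (v : V) : V → E :=
  fun x => limUnder (𝓝[≠] (0 : ℝ)) (diffQuot f v x)

/-- The iterated directional derivative along a list of vectors. -/
noncomputable def iterDeriv (f : V → E) : List V → V → E
  | [] => f
  | v :: vs => dirDeriv (iterDeriv f vs) v

/-- A function `f` with values in a Hausdorff locally convex space is smooth on the open set `U` of
the finite-dimensional space `V` if all its iterated directional derivatives exist on `U` and are
continuous there. -/
def SmoothOn (f : V → E) (U : Set V) : Prop :=
  ∀ vs : List V, ContinuousOn (iterDeriv f vs) U ∧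
    ∀ v : V, ∀ x ∈ U, ∃ y, Tendsto (diffQuot (iterDeriv f vs) v x) (𝓝[≠] 0) (𝓝 y)

lemma SmoothOn.tendsto [T2Space E] {f : V → E} {U : Set V} (hf : SmoothOn f U) (vs : List V)
    (v : V) {x : V} (hx : x ∈ U) :
    Tendsto (diffQuot (iterDeriv f vs) v x) (𝓝[≠] 0) (𝓝 (iterDeriv f (v :: vs) x)) := by
  obtain ⟨y, hy⟩ := (hf vs).2 v x hx
  have : iterDeriv f (v :: vs) x = y := hy.limUnder_eq
  rwa [this]

lemma diffQuot_const (c : E) (v x : V) : diffQuot (fun _ => c) v x = fun _ => 0 := by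
  funext t
  simp [diffQuot]

lemma diffQuot_eventuallyEq {f g : V → E} {U : Set V} (hU : IsOpen U) (h : EqOn f g U) (v : V)
    {x : V} (hx : x ∈ U) : diffQuot f v x =ᶠ[𝓝[≠] 0] diffQuot g v x := by
  have hc : Continuous fun t : ℝ => x + t • v := by fun_prop
  have : ∀ᶠ t in 𝓝 (0 : ℝ), x + t • v ∈ U :=
    hc.continuousAt.eventually_mem (hU.mem_nhds (by simpa using hx))
  filter_upwards [nhdsWithin_le_nhds this] with t ht
  simp only [diffQuot, h ht, h hx]

/-- A family of continuous functions which are successively directional derivatives of each other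
is the family of iterated directional derivatives. -/
lemma SmoothOn.of_family [T2Space E] {f : V → E} {U : Set V} (hU : IsOpen U)
    (D : List V → V → E) (h0 : EqOn (D []) f U) (hc : ∀ vs, ContinuousOn (D vs) U)
    (hD : ∀ vs v, ∀ x ∈ U, Tendsto (diffQuot (D vs) v x) (𝓝[≠] 0) (𝓝 (D (v :: vs) x))) :
    SmoothOn f U ∧ ∀ vs, EqOn (iterDeriv f vs) (D vs) U := by
  have key : ∀ vs, EqOn (iterDeriv f vs) (D vs) U := by
    intro vs
    induction vs with
    | nil => exact h0.symm
    | cons v vs ih =>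
      intro x hx
      exact ((hD vs v x hx).congr' (diffQuot_eventuallyEq hU ih v hx).symm).limUnder_eq
  refine ⟨fun vs => ⟨(hc vs).congr (key vs), fun v x hx => ⟨D (v :: vs) x, ?_⟩⟩, key⟩
  exact (hD vs v x hx).congr' (diffQuot_eventuallyEq hU (key vs) v hx).symm

lemma tendsto_of_diffQuot [IsTopologicalAddGroup E] [ContinuousSMul ℝ E] {f : V → E} {v x : V}
    {y : E} (h : Tendsto (diffQuot f v x) (𝓝[≠] 0) (𝓝 y)) :
    Tendsto (fun t : ℝ => f (x + t • v)) (𝓝[≠] 0) (𝓝 (f x)) := by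
  have h1 : Tendsto (fun t : ℝ => t • diffQuot f v x t + f x) (𝓝[≠] 0) (𝓝 ((0 : ℝ) • y + f x)) :=
    ((tendsto_nhdsWithin_of_tendsto_nhds tendsto_id).smul h).add tendsto_const_nhds
  rw [zero_smul, zero_add] at h1
  refine h1.congr' ?_
  filter_upwards [self_mem_nhdsWithin] with t ht
  have ht : t ≠ 0 := ht
  simp [diffQuot, smul_smul, ht]

/-- All the ways of distributing the entries of a list over two lists, as in the Leibniz rule. -/
def leibnizSplits {α : Type*} : List α → List (List α × List α)
  | [] => [([], [])]
  | v :: vs => (leibnizSplits vs).map (fun p => (v :: p.1, p.2)) ++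
      (leibnizSplits vs).map (fun p => (p.1, v :: p.2))

lemma SmoothOn.const [T2Space E] (c : E) {U : Set V} (hU : IsOpen U) :
    SmoothOn (fun _ : V => c) U := by
  refine (SmoothOn.of_family hU
    (fun vs => match vs with
      | [] => fun _ => c
      | _ :: _ => fun _ => 0) (fun _ _ => rfl) ?_ ?_).1
  · rintro (_ | ⟨v, vs⟩) <;> exact continuousOn_const
  · rintro (_ | ⟨w, vs⟩) v x hx <;> simp only [diffQuot_const] <;>
      exact tendsto_const_nhds (x := (0 : E))

lemma SmoothOn.add [T2Space E] [IsTopologicalAddGroup E] {f g : V → E} {U : Set V}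
    (hU : IsOpen U) (hf : SmoothOn f U) (hg : SmoothOn g U) :
    SmoothOn (fun x => f x + g x) U ∧
      ∀ vs, EqOn (iterDeriv (fun x => f x + g x) vs)
        (fun x => iterDeriv f vs x + iterDeriv g vs x) U := by
  refine SmoothOn.of_family hU (fun vs x => iterDeriv f vs x + iterDeriv g vs x)
    (fun _ _ => rfl) (fun vs => (hf vs).1.add (hg vs).1) fun vs v x hx => ?_
  refine ((hf.tendsto vs v hx).add (hg.tendsto vs v hx)).congr fun t => ?_
  simp only [diffQuot, ← smul_add]
  congr 1
  abel

lemma SmoothOn.clm [T2Space E] {F : Type*} [AddCommGroup F] [Module ℝ F] [TopologicalSpace F]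
    [T2Space F] {f : V → E} {U : Set V} (hU : IsOpen U) (hf : SmoothOn f U) (L : E →L[ℝ] F) :
    SmoothOn (fun x => L (f x)) U ∧
      ∀ vs, EqOn (iterDeriv (fun x => L (f x)) vs) (fun x => L (iterDeriv f vs x)) U := by
  refine SmoothOn.of_family hU (fun vs x => L (iterDeriv f vs x))
    (fun _ _ => rfl) (fun vs => L.continuous.comp_continuousOn (hf vs).1) fun vs v x hx => ?_
  refine ((L.continuous.tendsto _).comp (hf.tendsto vs v hx)).congr fun t => ?_
  simp [diffQuot]

lemma SmoothOn.mul {A : Type*} [Ring A] [Algebra ℝ A] [TopologicalSpace A] [T2Space A]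
    [IsTopologicalRing A] [ContinuousSMul ℝ A] {f g : V → A} {U : Set V}
    (hU : IsOpen U) (hf : SmoothOn f U) (hg : SmoothOn g U) :
    SmoothOn (fun x => f x * g x) U ∧
      ∀ vs, EqOn (iterDeriv (fun x => f x * g x) vs)
        (fun x => ((leibnizSplits vs).map
          fun p => iterDeriv f p.1 x * iterDeriv g p.2 x).sum) U := by
  refine SmoothOn.of_family hU (fun vs x => ((leibnizSplits vs).map
          fun p => iterDeriv f p.1 x * iterDeriv g p.2 x).sum)
    (fun x _ => show ((leibnizSplits []).map
      fun p => iterDeriv f p.1 x * iterDeriv g p.2 x).sum = f x * g x by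
        simp [leibnizSplits, iterDeriv]) (fun vs => ?_) fun vs v x hx => ?_
  · refine continuousOn_list_sum _ fun p _ => (hf p.1).1.mul (hg p.2).1
  · have h1 : ∀ p : List V × List V,
        Tendsto (diffQuot (fun x => iterDeriv f p.1 x * iterDeriv g p.2 x) v x) (𝓝[≠] 0)
          (𝓝 (iterDeriv f (v :: p.1) x * iterDeriv g p.2 x +
            iterDeriv f p.1 x * iterDeriv g (v :: p.2) x)) := by
      intro p
      refine (((hf.tendsto p.1 v hx).mul (tendsto_of_diffQuot (hg.tendsto p.2 v hx))).add
        ((tendsto_const_nhds (x := iterDeriv f p.1 x)).mul (hg.tendsto p.2 v hx))).congr fun t => ?_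
      simp only [diffQuot, smul_mul_assoc, mul_smul_comm, ← smul_add]
      congr 1
      noncomm_ring
    have h2 : ∀ l : List (List V × List V),
        Tendsto (diffQuot (fun x => (l.map
          fun p => iterDeriv f p.1 x * iterDeriv g p.2 x).sum) v x) (𝓝[≠] 0)
          (𝓝 (l.map fun p => iterDeriv f (v :: p.1) x * iterDeriv g p.2 x +
            iterDeriv f p.1 x * iterDeriv g (v :: p.2) x).sum) := by
      intro l
      induction l with
      | nil =>
        simp only [List.map_nil, List.sum_nil, diffQuot_const]
        exact tendsto_const_nhds (x := (0 : A))
      | cons p l ih =>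
        simp only [List.map_cons, List.sum_cons]
        refine ((h1 p).add ih).congr fun t => ?_
        simp only [diffQuot, ← smul_add]
        congr 1
        abel
    convert h2 (leibnizSplits vs) using 2
    simp [leibnizSplits, List.sum_map_add, Function.comp_def]

/-- Real functions which are smooth in the usual (Fréchet derivative) sense are smooth. -/
lemma SmoothOn.of_contDiffOn {f : V → ℝ} {U : Set V} (hU : IsOpen U) (hf : ContDiffOn ℝ ∞ f U) :
    SmoothOn f U := by
  let D : List V → V → ℝ := fun vs => vs.rec f fun v _ g x => fderiv ℝ g x v
  have hD : ∀ vs, ContDiffOn ℝ ∞ (D vs) U := by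
    intro vs
    induction vs with
    | nil => exact hf
    | cons v vs ih =>
      exact (ih.fderiv_of_isOpen hU (m := ∞) (by simp)).clm_apply contDiffOn_const
  refine (SmoothOn.of_family hU D (fun _ _ => rfl) (fun vs => (hD vs).continuousOn)
    fun vs v x hx => ?_).1
  have hd : DifferentiableAt ℝ (D vs) x :=
    ((hD vs).contDiffAt (hU.mem_nhds hx)).differentiableAt (by simp)
  have := hd.hasFDerivAt.hasLineDerivAt v
  exact this.tendsto_slope_zero

end Calculus

/-! ### The space of smooth functions on a manifold -/

section SmoothMap

/-- The space `C^∞(M, E)` of smooth functions on a manifold `M`, modelled on the finite-dimensional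
real vector space `V`, with values in a Hausdorff locally convex space `E`: the functions which are
smooth in every chart of the atlas. -/
structure SmoothMap (V : Type*) [NormedAddCommGroup V] [NormedSpace ℝ V]
    (M : Type*) [TopologicalSpace M] [ChartedSpace V M]
    (E : Type*) [AddCommGroup E] [Module ℝ E] [TopologicalSpace E] where
  /-- The underlying function. -/
  toFun : M → E
  smooth : ∀ φ ∈ atlas V M, SmoothOn (toFun ∘ φ.symm) φ.target

variable {V : Type*} [NormedAddCommGroup V] [NormedSpace ℝ V]
variable {M : Type*} [TopologicalSpace M] [ChartedSpace V M]

namespace SmoothMap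

section Module

variable {E : Type*} [AddCommGroup E] [Module ℝ E] [TopologicalSpace E]

instance : FunLike (SmoothMap V M E) M E where
  coe := toFun
  coe_injective f g h := by cases f; cases g; congr

@[ext] lemma ext {f g : SmoothMap V M E} (h : ∀ m, f m = g m) : f = g := DFunLike.ext _ _ h

lemma smoothOn (f : SmoothMap V M E) (φ : atlas V M) :
    SmoothOn (fun x => f (φ.1.symm x)) φ.1.target := f.smooth φ.1 φ.2

/-- The iterated derivative, along a list of vectors, of a smooth function in a chart, as a
continuous function on the image of the chart. -/
noncomputable def chartDeriv (φ : atlas V M) (vs : List V) (f : SmoothMap V M E) :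
    C(φ.1.target, E) :=
  ⟨φ.1.target.domRestrict (iterDeriv (fun x => f (φ.1.symm x)) vs),
    ((f.smoothOn φ) vs).1.domRestrict⟩

/-- The smooth compact open topology: the topology of compact convergence, in all charts, of all
iterated directional derivatives. -/
noncomputable instance : TopologicalSpace (SmoothMap V M E) :=
  ⨅ p : atlas V M × List V,
    TopologicalSpace.induced (chartDeriv p.1 p.2) ContinuousMap.compactOpen

lemma continuous_chartDeriv (φ : atlas V M) (vs : List V) :
    Continuous (chartDeriv φ vs : SmoothMap V M E → C(φ.1.target, E)) :=
  continuous_iff_le_induced.2 (iInf_le _ (φ, vs))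

lemma continuous_iff {X : Type*} [TopologicalSpace X] {F : X → SmoothMap V M E} :
    Continuous F ↔ ∀ (φ : atlas V M) (vs : List V), Continuous fun x => chartDeriv φ vs (F x) := by
  rw [continuous_iInf_rng, Prod.forall]
  simp only [continuous_induced_rng, Function.comp_def]

lemma continuous_eval (m : M) : Continuous fun f : SmoothMap V M E => f m := by
  have hm : chartAt V m m ∈ (chartAt V m).target := mem_chart_target V m
  have h := (continuous_chartDeriv (E := E) ⟨chartAt V m, chart_mem_atlas V m⟩ [])
  have h2 := (continuous_eval_const (F := C((chartAt V m).target, E))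
    (⟨chartAt V m m, hm⟩ : (chartAt V m).target)).comp h
  refine h2.congr fun f => ?_
  change f ((chartAt V m).symm (chartAt V m m)) = f m
  rw [(chartAt V m).left_inv (mem_chart_source V m)]

instance [T2Space E] : T2Space (SmoothMap V M E) :=
  T2Space.of_injective_continuous (f := fun f : SmoothMap V M E => (f : M → E))
    DFunLike.coe_injective (continuous_pi continuous_eval)

variable [T2Space E]

instance : Zero (SmoothMap V M E) := ⟨⟨fun _ => 0, fun φ _ => .const 0 φ.open_target⟩⟩

@[simp] lemma zero_apply (m : M) : (0 : SmoothMap V M E) m = 0 := rfl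

/-- Composition with a continuous linear map. -/
def clm {F : Type*} [AddCommGroup F] [Module ℝ F] [TopologicalSpace F] [T2Space F]
    (L : E →L[ℝ] F) (f : SmoothMap V M E) : SmoothMap V M F :=
  ⟨fun m => L (f m), fun φ hφ => (SmoothOn.clm φ.open_target (f.smooth φ hφ) L).1⟩

lemma chartDeriv_clm {F : Type*} [AddCommGroup F] [Module ℝ F] [TopologicalSpace F] [T2Space F]
    (L : E →L[ℝ] F) (f : SmoothMap V M E) (φ : atlas V M) (vs : List V) (x : φ.1.target) :
    chartDeriv φ vs (f.clm L) x = L (chartDeriv φ vs f x) :=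
  (SmoothOn.clm φ.1.open_target (f.smoothOn φ) L).2 vs x.2

section SMul

variable {S : Type*} [Monoid S] [DistribMulAction S E] [SMulCommClass ℝ S E]
  [ContinuousConstSMul S E]

/-- Multiplication by a scalar, as a continuous real linear map. -/
def smulCLM (c : S) : E →L[ℝ] E where
  toFun e := c • e
  map_add' := smul_add c
  map_smul' r e := (smul_comm r c e).symm
  cont := continuous_const_smul c

instance : SMul S (SmoothMap V M E) := ⟨fun c f => f.clm (smulCLM c)⟩

@[simp] lemma smul_apply (c : S) (f : SmoothMap V M E) (m : M) : (c • f) m = c • f m := rfl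

lemma chartDeriv_smul (c : S) (f : SmoothMap V M E) (φ : atlas V M) (vs : List V) :
    chartDeriv φ vs (c • f) = c • chartDeriv φ vs f :=
  ContinuousMap.ext fun x => chartDeriv_clm (smulCLM c) f φ vs x

instance [TopologicalSpace S] [ContinuousSMul S E] : ContinuousSMul S (SmoothMap V M E) := by
  refine ⟨continuous_iff.2 fun φ vs => ?_⟩
  simp only [chartDeriv_smul]
  exact continuous_fst.smul ((continuous_chartDeriv φ vs).comp continuous_snd)

instance : ContinuousConstSMul S (SmoothMap V M E) := by
  refine ⟨fun c => continuous_iff.2 fun φ vs => ?_⟩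
  simp only [chartDeriv_smul]
  exact (continuous_chartDeriv φ vs).const_smul c

end SMul

variable [IsTopologicalAddGroup E]

instance : Add (SmoothMap V M E) :=
  ⟨fun f g => ⟨fun m => f m + g m,
    fun φ hφ => (SmoothOn.add φ.open_target (f.smooth φ hφ) (g.smooth φ hφ)).1⟩⟩

@[simp] lemma add_apply (f g : SmoothMap V M E) (m : M) : (f + g) m = f m + g m := rfl

lemma chartDeriv_add (f g : SmoothMap V M E) (φ : atlas V M) (vs : List V) :
    chartDeriv φ vs (f + g) = chartDeriv φ vs f + chartDeriv φ vs g :=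
  ContinuousMap.ext fun x =>
    (SmoothOn.add φ.1.open_target (f.smoothOn φ) (g.smoothOn φ)).2 vs x.2

/-- Negation, as a continuous real linear map. -/
def negCLM : E →L[ℝ] E := -ContinuousLinearMap.id ℝ E

instance : Neg (SmoothMap V M E) := ⟨fun f => f.clm negCLM⟩

@[simp] lemma neg_apply (f : SmoothMap V M E) (m : M) : (-f) m = -f m := rfl

lemma chartDeriv_neg (f : SmoothMap V M E) (φ : atlas V M) (vs : List V) :
    chartDeriv φ vs (-f) = -chartDeriv φ vs f :=
  ContinuousMap.ext fun x => chartDeriv_clm negCLM f φ vs x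

instance : AddCommGroup (SmoothMap V M E) where
  add_assoc _ _ _ := ext fun _ => add_assoc _ _ _
  zero_add _ := ext fun _ => zero_add _
  add_zero _ := ext fun _ => add_zero _
  add_comm _ _ := ext fun _ => add_comm _ _
  neg_add_cancel _ := ext fun _ => neg_add_cancel _
  nsmul := nsmulRec
  zsmul := zsmulRec

@[simp] lemma sub_apply (f g : SmoothMap V M E) (m : M) : (f - g) m = f m - g m := by
  rw [sub_eq_add_neg, add_apply, neg_apply, sub_eq_add_neg]

instance : IsTopologicalAddGroup (SmoothMap V M E) where
  continuous_add := by
    refine continuous_iff.2 fun φ vs => ?_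
    simp only [chartDeriv_add]
    exact ((continuous_chartDeriv φ vs).comp continuous_fst).add
      ((continuous_chartDeriv φ vs).comp continuous_snd)
  continuous_neg := by
    refine continuous_iff.2 fun φ vs => ?_
    simp only [chartDeriv_neg]
    exact (continuous_chartDeriv φ vs).neg

instance {S : Type*} [Semiring S] [Module S E] [SMulCommClass ℝ S E] [ContinuousConstSMul S E] :
    Module S (SmoothMap V M E) where
  one_smul _ := ext fun _ => one_smul _ _
  mul_smul _ _ _ := ext fun _ => mul_smul _ _ _
  smul_zero _ := ext fun _ => smul_zero _
  smul_add _ _ _ := ext fun _ => smul_add _ _ _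
  add_smul _ _ _ := ext fun _ => add_smul _ _ _
  zero_smul _ := ext fun _ => zero_smul _ _

instance {S : Type*} [Semiring S] [Module S E] [SMulCommClass ℝ S E] [ContinuousConstSMul S E]
    [ContinuousConstSMul ℝ E] : SMulCommClass ℝ S (SmoothMap V M E) :=
  ⟨fun r s f => ext fun m => smul_comm r s (f m)⟩

instance {S : Type*} [Semiring S] [Module S E] [SMulCommClass ℝ S E] [ContinuousConstSMul S E]
    [ContinuousConstSMul ℝ E] [SMul ℝ S] [IsScalarTower ℝ S E] :
    IsScalarTower ℝ S (SmoothMap V M E) :=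
  ⟨fun r s f => ext fun m => smul_assoc r s (f m)⟩

instance [ContinuousSMul ℝ E] [LocallyConvexSpace ℝ E] :
    LocallyConvexSpace ℝ (SmoothMap V M E) :=
  LocallyConvexSpace.iInf fun p => LocallyConvexSpace.induced
    ({ toFun := chartDeriv p.1 p.2
       map_add' := fun f g => chartDeriv_add f g p.1 p.2
       map_smul' := fun c f => chartDeriv_smul c f p.1 p.2 } :
      SmoothMap V M E →ₗ[ℝ] C(p.1.1.target, E))

end Module

section Algebra

variable {A : Type*} [Ring A] [Algebra ℝ A] [TopologicalSpace A] [LocallyConvexAlgebra A]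

instance : One (SmoothMap V M A) := ⟨⟨fun _ => 1, fun φ _ => .const 1 φ.open_target⟩⟩

instance : Mul (SmoothMap V M A) :=
  ⟨fun f g => ⟨fun m => f m * g m,
    fun φ hφ => (SmoothOn.mul φ.open_target (f.smooth φ hφ) (g.smooth φ hφ)).1⟩⟩

@[simp] lemma one_apply (m : M) : (1 : SmoothMap V M A) m = 1 := rfl

@[simp] lemma mul_apply (f g : SmoothMap V M A) (m : M) : (f * g) m = f m * g m := rfl

/-- The pointwise ring structure. -/
instance : Ring (SmoothMap V M A) where
  __ := (inferInstance : AddCommGroup (SmoothMap V M A))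
  mul_assoc _ _ _ := ext fun _ => mul_assoc _ _ _
  one_mul _ := ext fun _ => one_mul _
  mul_one _ := ext fun _ => mul_one _
  left_distrib _ _ _ := ext fun _ => mul_add _ _ _
  right_distrib _ _ _ := ext fun _ => add_mul _ _ _
  zero_mul _ := ext fun _ => zero_mul _
  mul_zero _ := ext fun _ => mul_zero _

/-- The pointwise algebra structure. -/
instance {S : Type*} [CommSemiring S] [Algebra S A] [SMulCommClass ℝ S A]
    [ContinuousConstSMul S A] : Algebra S (SmoothMap V M A) :=
  Algebra.ofModule (fun _ _ _ => ext fun _ => smul_mul_assoc _ _ _)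
    (fun _ _ _ => ext fun _ => mul_smul_comm _ _ _)

lemma chartDeriv_mul (f g : SmoothMap V M A) (φ : atlas V M) (vs : List V) :
    chartDeriv φ vs (f * g) =
      ((leibnizSplits vs).map fun p => chartDeriv φ p.1 f * chartDeriv φ p.2 g).sum := by
  refine ContinuousMap.ext fun x => ?_
  have h := (SmoothOn.mul φ.1.open_target (f.smoothOn φ) (g.smoothOn φ)).2 vs x.2
  refine Eq.trans h ?_
  generalize leibnizSplits vs = l
  induction l with
  | nil => simp
  | cons p l ih =>
    simp only [List.map_cons, List.sum_cons, ContinuousMap.add_apply, ← ih]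
    rfl

/-- On a finite-dimensional manifold, the functions with values in a locally convex algebra form a
locally convex algebra. -/
instance [FiniteDimensional ℝ V] : LocallyConvexAlgebra (SmoothMap V M A) where
  continuous_add := continuous_add
  continuous_neg := continuous_neg
  continuous_mul := by
    refine continuous_iff.2 fun φ vs => ?_
    simp only [chartDeriv_mul]
    have : ProperSpace V := FiniteDimensional.proper ℝ V
    have : LocallyCompactSpace φ.1.target := φ.1.open_target.locallyCompactSpace
    exact continuous_list_sum _ fun p _ =>
      ((continuous_chartDeriv φ p.1).comp continuous_fst).mul
        ((continuous_chartDeriv φ p.2).comp continuous_snd)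
  continuous_smul := continuous_smul
  convex_basis := LocallyConvexSpace.convex_basis
  t2 := T2Space.t2

/-- The function `m ↦ f(m) 1_A` in `C^∞(M, A)` given by a smooth real function `f`. -/
noncomputable def ofReal (A : Type*) [Ring A] [Algebra ℝ A] [TopologicalSpace A]
    [LocallyConvexAlgebra A] [IsManifold 𝓘(ℝ, V) ∞ M] (f : C^∞⟮𝓘(ℝ, V), M; ℝ⟯) :
    SmoothMap V M A :=
  SmoothMap.clm ((ContinuousLinearMap.id ℝ ℝ).smulRight (1 : A))
    ⟨f, fun φ hφ => SmoothOn.of_contDiffOn φ.open_target (contMDiffOn_iff_contDiffOn.1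
      (f.contMDiff.comp_contMDiffOn
        (contMDiffOn_symm_of_mem_maximalAtlas
          (IsManifold.subset_maximalAtlas hφ))))⟩

@[simp] lemma ofReal_apply [IsManifold 𝓘(ℝ, V) ∞ M] (f : C^∞⟮𝓘(ℝ, V), M; ℝ⟯) (m : M) :
    ofReal A f m = f m • (1 : A) := rfl

end Algebra

end SmoothMap

end SmoothMap

/-! ### Smooth localization -/

section Localization

variable {B : Type*} [Ring B] [Algebra ℝ B] [TopologicalSpace B] [LocallyConvexAlgebra B]

/-- The function `t ↦ 1 - t a` in `B{t} = C^∞(ℝ, B)`. -/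
def localizer (a : B) : SmoothMap ℝ ℝ B where
  toFun t := 1 - t • a
  smooth := by
    let id' : C^∞⟮𝓘(ℝ, ℝ), ℝ; ℝ⟯ := ⟨fun t => t, contMDiff_id⟩
    let c : SmoothMap ℝ ℝ B := ⟨fun _ => a, fun φ _ => .const a φ.open_target⟩
    have h : (fun t : ℝ => 1 - t • a) = (1 - SmoothMap.ofReal B id' * c : SmoothMap ℝ ℝ B) := by
      funext t
      rw [SmoothMap.sub_apply, SmoothMap.mul_apply, SmoothMap.ofReal_apply, smul_one_mul]
      rfl
    rw [h]
    exact (1 - SmoothMap.ofReal B id' * c : SmoothMap ℝ ℝ B).smooth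

/-- The closure of the two-sided ideal of `C^∞(ℝ, B)` generated by the function `t ↦ 1 - t a`. -/
noncomputable def localizationIdeal (a : B) : Ideal (SmoothMap ℝ ℝ B) :=
  (TwoSidedIdeal.span {localizer a}).asIdeal.closure

instance (a : B) : (localizationIdeal a).IsTwoSided :=
  ⟨fun c hx => map_mem_closure (f := fun y => y * c) (continuous_mul_const c) hx
    fun _ hy => (TwoSidedIdeal.span {localizer a}).asIdeal.mul_mem_right c hy⟩

instance (a : B) : IsClosed (localizationIdeal a : Set (SmoothMap ℝ ℝ B)) := isClosed_closure

/-- The smooth localization of the locally convex algebra `B` with respect to `a`, with its quotient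
algebra structure and its quotient topology. -/
abbrev SmoothLocalization (a : B) : Type _ := SmoothMap ℝ ℝ B ⧸ localizationIdeal a

/-- The class `[F]` in the smooth localization of `F ∈ C^∞(ℝ, B)`. -/
noncomputable abbrev SmoothLocalization.mk (a : B) : SmoothMap ℝ ℝ B →+* SmoothLocalization a :=
  Ideal.Quotient.mk (localizationIdeal a)

lemma SmoothLocalization.isOpenQuotientMap_mk (a : B) :
    IsOpenQuotientMap (SmoothLocalization.mk a) :=
  QuotientAddGroup.isOpenQuotientMap_mk

instance {S : Type*} [TopologicalSpace S] [CommSemiring S] [Algebra S B] [SMulCommClass ℝ S B]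
    [ContinuousSMul S B] (a : B) : ContinuousSMul S (SmoothLocalization a) where
  continuous_smul := (IsOpenQuotientMap.id.prodMap
    (SmoothLocalization.isOpenQuotientMap_mk a)).isQuotientMap.continuous_iff.2
      ((SmoothLocalization.isOpenQuotientMap_mk a).continuous.comp
        (continuous_smul (M := S) (X := SmoothMap ℝ ℝ B)))

instance (a : B) : LocallyConvexSpace ℝ (SmoothLocalization a) := by
  refine (locallyConvexSpace_iff_exists_convex_subset_zero ℝ (SmoothLocalization a)).2 ?_
  intro U hU
  have hq := SmoothLocalization.isOpenQuotientMap_mk a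
  obtain ⟨W, hW, hWc, hWU⟩ := (locallyConvexSpace_iff_exists_convex_subset_zero ℝ
    (SmoothMap ℝ ℝ B)).1 inferInstance (SmoothLocalization.mk a ⁻¹' U)
      (hq.continuous.continuousAt.preimage_mem_nhds (by rwa [map_zero]))
  refine ⟨SmoothLocalization.mk a '' W, ?_, ?_, image_subset_iff.2 hWU⟩
  · have := hq.isOpenMap.image_mem_nhds hW
    rwa [map_zero] at this
  · exact hWc.linear_image (Ideal.Quotient.mkₐ ℝ (localizationIdeal a)).toLinearMap

/-- The smooth localization is a locally convex algebra. -/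
instance (a : B) : LocallyConvexAlgebra (SmoothLocalization a) where
  continuous_add := continuous_add
  continuous_neg := continuous_neg
  continuous_mul := ((SmoothLocalization.isOpenQuotientMap_mk a).prodMap
    (SmoothLocalization.isOpenQuotientMap_mk a)).isQuotientMap.continuous_iff.2
      ((SmoothLocalization.isOpenQuotientMap_mk a).continuous.comp
        (continuous_mul (M := SmoothMap ℝ ℝ B)))
  continuous_smul := continuous_smul
  convex_basis := LocallyConvexSpace.convex_basis
  t2 := T2Space.t2

end Localization

/-- The open submanifold `M_f = {m ∈ M : f(m) ≠ 0}` of `M`. -/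
def nonvanishingLocus {V : Type*} [NormedAddCommGroup V] [NormedSpace ℝ V]
    {M : Type*} [TopologicalSpace M] [ChartedSpace V M] (f : C^∞⟮𝓘(ℝ, V), M; ℝ⟯) :
    TopologicalSpace.Opens M :=
  ⟨{m | f m ≠ 0}, isOpen_ne_fun f.contMDiff.continuous continuous_const⟩

/-! ### The mean value theorem in locally convex spaces -/

section MeanValue

variable {V : Type*} [NormedAddCommGroup V] [NormedSpace ℝ V]
variable {E : Type*} [AddCommGroup E] [Module ℝ E] [TopologicalSpace E]
  [IsTopologicalAddGroup E] [ContinuousSMul ℝ E] [LocallyConvexSpace ℝ E]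

/-! A smooth curve `F` in `C^∞(M, A)` is a smooth function on `ℝ × M`, and the map in question
restricts it to the graph of `1 / f`, a copy of `M_f`. This restriction `evalInv` is a continuous
homomorphism which kills `1 - t f`, hence the closed ideal `I` generated by it. Two facts remain.

It has a continuous section. If `χ` is smooth with `χ 1 = 1` and `χ = 0` near `0`, then `g ↦ χ(t
f(m)) g(m)`, extended by zero, is smooth on `ℝ × M` and restricts to `g` on the graph
(`exists_continuous_rightInverse_evalInv`). Continuity of the inverse thus needs no open mapping
theorem.

Its kernel is contained in `I` (`mem_localizationIdeal_of_evalInv_eq_zero`). Slide `F` onto the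
graph by `K_s(t)(m) = χ(t f(m)) F(t + s (1/f(m) - t))(m)`. If `F` vanishes on the graph, then `K_1 =
0`. Since `1 - χ(u) = (1 - u) ρ(u)`, the difference `F - K_0` is a multiple of `1 - t f`; since
`χ(u) = u w(u)`, so is the `s`-derivative of `K_s`, because `χ(t f) (1/f - t) = (1 - t f) t w(t f)`.
As `I` is closed and convex, the mean value theorem `Convex.sub_mem_of_diffQuot` gives `K_1 - K_0 ∈
I`, so `F ∈ I`.

The analysis rests on the exponential law (`JointlySmooth.smoothFamOn`, `jointlySmooth_uncurry`),
proved for families depending continuously on a parameter. Taking the smooth map itself as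
parameter, one argument yields both the smoothness of each value and the continuity of the operator.
The Fréchet property is proved for `C^∞(U, A)` and carried to the localization by the isomorphism.
-/

lemma exists_isClosed_convex_nhds_subset {e : E} {N : Set E} (hN : N ∈ 𝓝 e) :
    ∃ C ∈ 𝓝 e, IsClosed C ∧ Convex ℝ C ∧ C ⊆ N := by
  obtain ⟨K, ⟨hK, hKc⟩, hKN⟩ := (closed_nhds_basis e).mem_iff.1 hN
  obtain ⟨S, hS, hSc, hSK⟩ :=
    (locallyConvexSpace_iff_exists_convex_subset ℝ E).1 inferInstance e K hK
  exact ⟨closure S, mem_of_superset hS subset_closure, isClosed_closure, hSc.closure,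
    (closure_minimal hSK hKc).trans hKN⟩

/-- A curve whose derivative takes its values in a closed convex set has its increments there. -/
theorem Convex.sub_mem_of_diffQuot {C : Set E} (hC : Convex ℝ C) (hCc : IsClosed C)
    {γ γ' : ℝ → E} (hγ : ∀ s ∈ Icc (0 : ℝ) 1, Tendsto (diffQuot γ 1 s) (𝓝[≠] 0) (𝓝 (γ' s)))
    (hγ' : ∀ s ∈ Icc (0 : ℝ) 1, γ' s ∈ C) : γ 1 - γ 0 ∈ C := by
  by_contra hnot
  -- A functional separating the increment from `C` reduces the claim to the scalar mean value
  -- theorem.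
  obtain ⟨l, u, hlu, hul⟩ := geometric_hahn_banach_closed_point hC hCc hnot
  have hder : ∀ s ∈ Icc (0 : ℝ) 1, HasDerivAt (fun s => l (γ s)) (l (γ' s)) s := by
    intro s hs
    rw [hasDerivAt_iff_tendsto_slope_zero]
    refine ((l.continuous.tendsto _).comp (hγ s hs)).congr fun t => ?_
    simp [diffQuot]
  obtain ⟨c, hc, hceq⟩ := exists_hasDerivAt_eq_slope (fun s => l (γ s)) (fun s => l (γ' s))
    zero_lt_one (fun s hs => (hder s hs).continuousAt.continuousWithinAt)
    fun s hs => hder s (Ioo_subset_Icc_self hs)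
  have := hlu _ (hγ' c (Ioo_subset_Icc_self hc))
  rw [map_sub] at hul
  simp only [sub_zero, div_one] at hceq
  linarith

/-- The difference quotient is the increment over `[0, 1]` of `s ↦ τ⁻¹ g(x + s τ v)`, whose
derivative is `g'(x + s τ v)`. Only the segment from `x` to `x + τ v` matters. -/
theorem Convex.diffQuot_mem {C : Set E} (hC : Convex ℝ C) (hCc : IsClosed C) {g g' : V → E}
    {x v : V} {τ : ℝ} (hτ : τ ≠ 0)
    (hg : ∀ s ∈ Icc (0 : ℝ) 1,
      Tendsto (diffQuot g v (x + (s * τ) • v)) (𝓝[≠] 0) (𝓝 (g' (x + (s * τ) • v))))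
    (hg' : ∀ s ∈ Icc (0 : ℝ) 1, g' (x + (s * τ) • v) ∈ C) : diffQuot g v x τ ∈ C := by
  have h := hC.sub_mem_of_diffQuot hCc (γ := fun s => τ⁻¹ • g (x + (s * τ) • v))
    (γ' := fun s => g' (x + (s * τ) • v)) (fun s hs => ?_) hg'
  · simpa [diffQuot, smul_sub] using h
  · have h0 : Tendsto (fun t : ℝ => t * τ) (𝓝[≠] 0) (𝓝[≠] 0) := by
      refine tendsto_nhdsWithin_iff.2 ⟨?_, ?_⟩
      · have : Tendsto (fun t : ℝ => t * τ) (𝓝 0) (𝓝 (0 * τ)) :=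
          (continuous_mul_const τ).tendsto 0
        rw [zero_mul] at this
        exact this.mono_left nhdsWithin_le_nhds
      · filter_upwards [self_mem_nhdsWithin] with t ht
        exact mul_ne_zero ht hτ
    refine ((hg s hs).comp h0).congr fun t => ?_
    simp only [diffQuot, Function.comp_apply, ← smul_sub, smul_smul, smul_eq_mul, mul_one, add_mul,
      add_smul, mul_inv, add_assoc]

/-- The difference quotients of a continuously differentiable function converge locally
uniformly. -/
theorem tendsto_diffQuot_prod {g g' : V → E} {U : Set V} (hU : IsOpen U) {v y : V} (hy : y ∈ U)
    (hg' : ContinuousAt g' y) (hg : ∀ z ∈ U, Tendsto (diffQuot g v z) (𝓝[≠] 0) (𝓝 (g' z))) :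
    Tendsto (fun p : V × ℝ => if p.2 = 0 then g' p.1 else diffQuot g v p.1 p.2) (𝓝 (y, 0))
      (𝓝 (g' y)) := by
  intro N hN
  obtain ⟨C, hC, hCc, hCconv, hCN⟩ := exists_isClosed_convex_nhds_subset hN
  have hmem : U ∩ g' ⁻¹' C ∈ 𝓝 y := inter_mem (hU.mem_nhds hy) (hg' hC)
  obtain ⟨r, hr, hrC⟩ := Metric.mem_nhds_iff.1 hmem
  have hcont : Continuous fun p : V × ℝ => ‖p.1 - y‖ + |p.2| * ‖v‖ := by fun_prop
  have hev : ∀ᶠ p in 𝓝 ((y, 0) : V × ℝ), ‖p.1 - y‖ + |p.2| * ‖v‖ < r :=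
    hcont.continuousAt.eventually_lt continuousAt_const (by simpa using hr)
  rw [mem_map]
  filter_upwards [hev] with p hp
  have key : ∀ s ∈ Icc (0 : ℝ) 1, p.1 + (s * p.2) • v ∈ U ∩ g' ⁻¹' C := by
    intro s hs
    apply hrC
    rw [Metric.mem_ball, dist_eq_norm]
    calc ‖p.1 + (s * p.2) • v - y‖ = ‖(p.1 - y) + (s * p.2) • v‖ := by congr 1; abel
      _ ≤ ‖p.1 - y‖ + ‖(s * p.2) • v‖ := norm_add_le _ _
      _ ≤ ‖p.1 - y‖ + |p.2| * ‖v‖ := by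
        rw [norm_smul, norm_mul, Real.norm_eq_abs, Real.norm_eq_abs, abs_of_nonneg hs.1]
        gcongr
        exact mul_le_of_le_one_left (abs_nonneg _) hs.2
      _ < r := hp
  change (if p.2 = 0 then g' p.1 else diffQuot g v p.1 p.2) ∈ N
  apply hCN
  split_ifs with h0
  · simpa using (key 0 (by simp)).2
  · exact hCconv.diffQuot_mem hCc h0 (fun s hs => hg _ (key s hs).1) fun s hs => (key s hs).2

/-- The chain rule along a curve, for a function with continuous partial derivatives. -/
theorem tendsto_comp_of_partial {ι : Type*} [Fintype ι] (b : Module.Basis ι ℝ V)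
    [FiniteDimensional ℝ V] {g : V → E} {g' : ι → V → E} {U : Set V} (hU : IsOpen U) {y : V}
    (hy : y ∈ U) (hg' : ∀ i, ContinuousAt (g' i) y)
    (hg : ∀ i, ∀ z ∈ U, Tendsto (diffQuot g (b i) z) (𝓝[≠] 0) (𝓝 (g' i z)))
    {κ : ℝ → V} {a : V} (hκ : Tendsto (fun t : ℝ => t⁻¹ • (κ t - y)) (𝓝[≠] 0) (𝓝 a)) :
    Tendsto (fun t : ℝ => t⁻¹ • (g (κ t) - g y)) (𝓝[≠] 0) (𝓝 (∑ i, b.repr a i • g' i y)) := by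
  classical
  have hcoord : ∀ i, Continuous fun w : V => b.repr w i := fun i =>
    (b.coord i).continuous_of_finiteDimensional
  have hτ : ∀ i, Tendsto (fun t : ℝ => t⁻¹ * b.repr (κ t - y) i) (𝓝[≠] 0) (𝓝 (b.repr a i)) := by
    intro i
    refine (((hcoord i).tendsto a).comp hκ).congr fun t => ?_
    simp
  have hτ0 : ∀ i, Tendsto (fun t : ℝ => b.repr (κ t - y) i) (𝓝[≠] 0) (𝓝 0) := by
    intro i
    have h1 : Tendsto (fun t : ℝ => t) (𝓝[≠] 0) (𝓝 0) := nhdsWithin_le_nhds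
    have h2 := h1.mul (hτ i)
    rw [zero_mul] at h2
    refine h2.congr' ?_
    filter_upwards [self_mem_nhdsWithin] with t ht
    have ht : t ≠ 0 := ht
    field_simp
  -- Pass from `y` to `κ t` one coordinate at a time. The base point of each increment moves with
  -- `t`, which is why joint convergence of the difference quotients is needed; their value at step
  -- `0` covers a vanishing coordinate.
  have key : ∀ s : Finset ι,
      Tendsto (fun t : ℝ => t⁻¹ • (g (y + ∑ i ∈ s, b.repr (κ t - y) i • b i) - g y)) (𝓝[≠] 0)
        (𝓝 (∑ i ∈ s, b.repr a i • g' i y)) := by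
    intro s
    induction s using Finset.induction_on with
    | empty =>
      simp only [Finset.sum_empty, add_zero, sub_self, smul_zero]
      exact tendsto_const_nhds
    | insert i s hi ih =>
      rw [Finset.sum_insert hi, add_comm]
      have hz : Tendsto (fun t : ℝ => ((y + ∑ i ∈ s, b.repr (κ t - y) i • b i,
          b.repr (κ t - y) i) : V × ℝ)) (𝓝[≠] 0) (𝓝 (y, 0)) := by
        refine Tendsto.prodMk_nhds ?_ (hτ0 i)
        have := (tendsto_const_nhds (x := y)).add
          (tendsto_finsetSum s fun j _ => (hτ0 j).smul (tendsto_const_nhds (x := b j)))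
        simpa using this
      have hq := (tendsto_diffQuot_prod hU hy (hg' i) (hg i)).comp hz
      refine (ih.add ((hτ i).smul hq)).congr fun t => ?_
      simp only [Function.comp_apply]
      rw [Finset.sum_insert hi]
      split_ifs with h0
      · rw [h0, mul_zero, zero_smul, zero_smul, add_zero, zero_add]
      · simp only [diffQuot]
        rw [smul_smul, mul_assoc, mul_inv_cancel₀ h0, mul_one, ← smul_add]
        congr 1
        rw [add_comm (b.repr (κ t - y) i • b i), ← add_assoc]
        abel
  refine (key Finset.univ).congr fun t => ?_
  rw [b.sum_repr, add_sub_cancel]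

/-- Second directional derivatives commute. -/
theorem diffQuot_swap [T2Space E] {g gv gw gvw gwv : V → E} {U : Set V} (hU : IsOpen U) {v w y : V}
    (hy : y ∈ U) (hv : ∀ z ∈ U, Tendsto (diffQuot g v z) (𝓝[≠] 0) (𝓝 (gv z)))
    (hw : ∀ z ∈ U, Tendsto (diffQuot g w z) (𝓝[≠] 0) (𝓝 (gw z)))
    (hvw : ∀ z ∈ U, Tendsto (diffQuot gw v z) (𝓝[≠] 0) (𝓝 (gvw z)))
    (hwv : ∀ z ∈ U, Tendsto (diffQuot gv w z) (𝓝[≠] 0) (𝓝 (gwv z)))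
    (cvw : ContinuousAt gvw y) (cwv : ContinuousAt gwv y) : gvw y = gwv y := by
  -- the symmetric second difference lies close to both mixed derivatives
  have aux : ∀ (v w : V) (gv gwv : V → E)
      (_ : ∀ z ∈ U, Tendsto (diffQuot g v z) (𝓝[≠] 0) (𝓝 (gv z)))
      (_ : ∀ z ∈ U, Tendsto (diffQuot gv w z) (𝓝[≠] 0) (𝓝 (gwv z)))
      (_ : ContinuousAt gwv y), Tendsto (fun t : ℝ => (t⁻¹ * t⁻¹) •
        (g (y + t • v + t • w) - g (y + t • v) - g (y + t • w) + g y)) (𝓝[≠] 0)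
        (𝓝 (gwv y)) := by
    intro v w gv gwv hv hwv cwv N hN
    obtain ⟨C, hC, hCc, hCconv, hCN⟩ := exists_isClosed_convex_nhds_subset hN
    have hmem : U ∩ gwv ⁻¹' C ∈ 𝓝 y := inter_mem (hU.mem_nhds hy) (cwv hC)
    obtain ⟨r, hr, hrC⟩ := Metric.mem_nhds_iff.1 hmem
    have hcont : Continuous fun t : ℝ => |t| * ‖v‖ + |t| * ‖w‖ := by fun_prop
    have hev : ∀ᶠ t in 𝓝 (0 : ℝ), |t| * ‖v‖ + |t| * ‖w‖ < r :=
      hcont.continuousAt.eventually_lt continuousAt_const (by simpa using hr)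
    rw [mem_map]
    filter_upwards [self_mem_nhdsWithin, nhdsWithin_le_nhds hev] with t ht0 ht
    have ht0 : t ≠ 0 := ht0
    have key : ∀ s ∈ Icc (0 : ℝ) 1, ∀ s' ∈ Icc (0 : ℝ) 1,
        y + (s * t) • v + (s' * t) • w ∈ U ∩ gwv ⁻¹' C := by
      intro s hs s' hs'
      apply hrC
      rw [Metric.mem_ball, dist_eq_norm]
      calc ‖y + (s * t) • v + (s' * t) • w - y‖ = ‖(s * t) • v + (s' * t) • w‖ := by
            congr 1; abel
        _ ≤ ‖(s * t) • v‖ + ‖(s' * t) • w‖ := norm_add_le _ _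
        _ ≤ |t| * ‖v‖ + |t| * ‖w‖ := by
          rw [norm_smul, norm_mul, norm_smul, norm_mul, Real.norm_eq_abs, Real.norm_eq_abs,
            Real.norm_eq_abs, abs_of_nonneg hs.1, abs_of_nonneg hs'.1]
          gcongr
          · exact mul_le_of_le_one_left (abs_nonneg _) hs.2
          · exact mul_le_of_le_one_left (abs_nonneg _) hs'.2
        _ < r := ht
    apply hCN
    have h01 : (1 : ℝ) ∈ Icc (0 : ℝ) 1 := by simp
    have h00 : (0 : ℝ) ∈ Icc (0 : ℝ) 1 := by simp
    have hU' : ∀ s ∈ Icc (0 : ℝ) 1, y + (s * t) • v ∈ U := fun s hs => by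
      simpa using (key s hs 0 h00).1
    -- Mean value theorem twice: first in direction `v` for the quotient of `g` in direction `w`,
    -- then in direction `w` for `gv`.
    have := hCconv.diffQuot_mem hCc (g := fun z => t⁻¹ • (g (z + t • w) - g z))
      (g' := fun z => t⁻¹ • (gv (z + t • w) - gv z)) (x := y) (v := v) ht0 ?_ ?_
    · convert this using 1
      simp only [diffQuot, ← smul_sub, smul_smul]
      congr 1
      abel
    · intro s hs
      have h1 := hv _ (hU' s hs)
      have h2 := hv (y + (s * t) • v + t • w) (by simpa using (key s hs 1 h01).1)
      refine ((h2.sub h1).const_smul t⁻¹).congr fun τ => ?_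
      simp only [diffQuot, ← smul_sub]
      rw [smul_comm]
      congr 2
      rw [add_right_comm _ (τ • v) (t • w)]
      abel
    · intro s hs
      exact hCconv.diffQuot_mem hCc ht0 (fun s' hs' => hwv _ (key s hs s' hs').1)
        fun s' hs' => (key s hs s' hs').2
  -- The second difference is symmetric in `v` and `w`, so both mixed derivatives are its limit.
  refine tendsto_nhds_unique (aux w v gw gvw hw hvw cvw)
    ((aux v w gv gwv hv hwv cwv).congr fun t => ?_)
  rw [add_right_comm y]
  congr 1
  abel

end MeanValue

/-! ### Families of smooth functions depending continuously on a parameter -/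

lemma IsOpen.slice {X Y : Type*} [TopologicalSpace X] [TopologicalSpace Y] {Ω : Set (Y × X)}
    (hΩ : IsOpen Ω) (y : Y) : IsOpen {x | (y, x) ∈ Ω} :=
  hΩ.preimage (by fun_prop : Continuous fun x : X => (y, x))

section Family

variable {Y : Type*} [TopologicalSpace Y]
variable {V : Type*} [NormedAddCommGroup V] [NormedSpace ℝ V]
variable {E : Type*} [AddCommGroup E] [Module ℝ E] [TopologicalSpace E]

/-- A family of functions `g y`, smooth on the slices of `Ω ⊆ Y × V`, all of whose iterated
directional derivatives are jointly continuous on `Ω`. -/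
def SmoothFamOn (g : Y → V → E) (Ω : Set (Y × V)) : Prop :=
  ∀ vs : List V, ContinuousOn (fun p : Y × V => iterDeriv (g p.1) vs p.2) Ω ∧
    ∀ v : V, ∀ p ∈ Ω, ∃ e, Tendsto (diffQuot (iterDeriv (g p.1) vs) v p.2) (𝓝[≠] 0) (𝓝 e)

/-- A set of jointly continuous families of functions which is stable under taking directional
derivatives along the vectors `β i`. -/
def DerivClosed {ι : Type*} (β : ι → V) (Ω : Set (Y × V)) (D : Set (Y → V → E)) : Prop :=
  ∀ g ∈ D, ContinuousOn (fun p : Y × V => g p.1 p.2) Ω ∧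
    ∀ i, ∃ g' ∈ D, ∀ p ∈ Ω, Tendsto (diffQuot (g p.1) (β i) p.2) (𝓝[≠] 0) (𝓝 (g' p.1 p.2))

lemma iterDeriv_append (f : V → E) (vs ws : List V) :
    iterDeriv f (vs ++ ws) = iterDeriv (iterDeriv f ws) vs := by
  induction vs with
  | nil => rfl
  | cons v vs ih => simp only [List.cons_append, iterDeriv, ih]

lemma iterDeriv_congr {f g : V → E} {U : Set V} (hU : IsOpen U) (h : EqOn f g U) (vs : List V) :
    EqOn (iterDeriv f vs) (iterDeriv g vs) U := by
  induction vs with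
  | nil => exact h
  | cons v vs ih =>
    intro x hx
    simp only [iterDeriv, dirDeriv, limUnder, map_congr (diffQuot_eventuallyEq hU ih v hx)]

lemma DerivClosed.exists_iterDeriv [T2Space E] {Ω : Set (Y × V)} (hΩ : IsOpen Ω)
    {D : Set (Y → V → E)} (hD : DerivClosed (id : V → V) Ω D) {g : Y → V → E} (hg : g ∈ D)
    (vs : List V) : ∃ h ∈ D, ∀ p ∈ Ω, iterDeriv (g p.1) vs p.2 = h p.1 p.2 := by
  induction vs with
  | nil => exact ⟨g, hg, fun _ _ => rfl⟩
  | cons v vs ih =>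
    obtain ⟨h, hh, heq⟩ := ih
    obtain ⟨h', hh', hlim⟩ := (hD h hh).2 v
    exact ⟨h', hh', fun p hp => ((hlim p hp).congr' (diffQuot_eventuallyEq (hΩ.slice p.1)
      (fun x hx => heq (p.1, x) hx) v hp).symm).limUnder_eq⟩

/-- The coinductive principle for families of smooth functions. -/
theorem DerivClosed.smoothFamOn [T2Space E] {Ω : Set (Y × V)} (hΩ : IsOpen Ω)
    {D : Set (Y → V → E)} (hD : DerivClosed (id : V → V) Ω D) {g : Y → V → E} (hg : g ∈ D) :
    SmoothFamOn g Ω := by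
  intro vs
  obtain ⟨h, hh, heq⟩ := hD.exists_iterDeriv hΩ hg vs
  refine ⟨(hD h hh).1.congr heq, fun v p hp => ?_⟩
  obtain ⟨h', hh', hlim⟩ := (hD h hh).2 v
  exact ⟨_, (hlim p hp).congr' (diffQuot_eventuallyEq (hΩ.slice p.1)
    (fun x hx => heq (p.1, x) hx) v hp).symm⟩

namespace SmoothFamOn

variable {g : Y → V → E} {Ω : Set (Y × V)}

lemma tendsto [T2Space E] (hg : SmoothFamOn g Ω) (vs : List V) (v : V) {p : Y × V} (hp : p ∈ Ω) :
    Tendsto (diffQuot (iterDeriv (g p.1) vs) v p.2) (𝓝[≠] 0)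
      (𝓝 (iterDeriv (g p.1) (v :: vs) p.2)) := by
  obtain ⟨e, he⟩ := (hg vs).2 v p hp
  have : iterDeriv (g p.1) (v :: vs) p.2 = e := he.limUnder_eq
  rwa [this]

/-- Converse to `DerivClosed.smoothFamOn`, with freely chosen directions; a basis is the choice
needed for pullbacks. -/
lemma derivClosed [T2Space E] (hg : SmoothFamOn g Ω) {ι : Type*} (β : ι → V) :
    DerivClosed β Ω (range fun (vs : List V) (y : Y) => iterDeriv (g y) vs) := by
  rintro _ ⟨vs, rfl⟩
  exact ⟨(hg vs).1, fun i => ⟨_, ⟨β i :: vs, rfl⟩, fun p hp => hg.tendsto vs (β i) hp⟩⟩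

lemma congr (hg : SmoothFamOn g Ω) (hΩ : IsOpen Ω) {g' : Y → V → E}
    (h : ∀ p ∈ Ω, g' p.1 p.2 = g p.1 p.2) : SmoothFamOn g' Ω := by
  have key : ∀ vs, ∀ p ∈ Ω, iterDeriv (g' p.1) vs p.2 = iterDeriv (g p.1) vs p.2 :=
    fun vs p hp => iterDeriv_congr (hΩ.slice p.1) (fun x hx => h (p.1, x) hx) vs hp
  refine fun vs => ⟨(hg vs).1.congr (key vs), fun v p hp => ?_⟩
  obtain ⟨e, he⟩ := (hg vs).2 v p hp
  exact ⟨e, he.congr' (diffQuot_eventuallyEq (hΩ.slice p.1)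
    (fun x hx => key vs (p.1, x) hx) v hp).symm⟩

/-- `iterDeriv` is defined on all of `V` without reference to a domain, so the conditions are local.
-/
lemma of_locally (h : ∀ p ∈ Ω, ∃ Ω', IsOpen Ω' ∧ p ∈ Ω' ∧ SmoothFamOn g Ω') :
    SmoothFamOn g Ω := by
  refine fun vs => ⟨fun p hp => ?_, fun v p hp => ?_⟩
  · obtain ⟨Ω', ho, hp', hg⟩ := h p hp
    exact ((hg vs).1.continuousAt (ho.mem_nhds hp')).continuousWithinAt
  · obtain ⟨Ω', ho, hp', hg⟩ := h p hp
    exact (hg vs).2 v p hp'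

lemma mono (hg : SmoothFamOn g Ω) {Ω' : Set (Y × V)} (h : Ω' ⊆ Ω) : SmoothFamOn g Ω' :=
  fun vs => ⟨(hg vs).1.mono h, fun v p hp => (hg vs).2 v p (h hp)⟩

lemma zero [T2Space E] (hΩ : IsOpen Ω) : SmoothFamOn (fun (_ : Y) (_ : V) => (0 : E)) Ω := by
  refine DerivClosed.smoothFamOn (D := {fun _ _ => 0}) hΩ ?_ rfl
  rintro _ rfl
  refine ⟨continuousOn_const, fun v => ⟨_, rfl, fun p _ => ?_⟩⟩
  rw [diffQuot_const]
  exact tendsto_const_nhds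

lemma smoothOn {U : Set V} (hg : SmoothFamOn g Ω) (y : Y) (hU : ∀ x ∈ U, (y, x) ∈ Ω) :
    SmoothOn (g y) U := fun vs =>
  ⟨(hg vs).1.comp (by fun_prop : Continuous fun x : V => (y, x)).continuousOn hU,
    fun v x hx => (hg vs).2 v (y, x) (hU x hx)⟩

/-- Lists are differentiated from the right, so differentiating along `v` first appends `v`; no
symmetry of derivatives is involved. -/
lemma dirDeriv (hg : SmoothFamOn g Ω) (v : V) : SmoothFamOn (fun y => dirDeriv (g y) v) Ω := by
  intro vs
  have : ∀ y, iterDeriv (_root_.dirDeriv (g y) v) vs = iterDeriv (g y) (vs ++ [v]) := fun y => by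
    rw [iterDeriv_append]; rfl
  simp only [this]
  exact hg _

end SmoothFamOn

/-- Families with continuous iterated partial derivatives along a basis are smooth, and so are their
pullbacks along smooth maps. -/
theorem DerivClosed.smoothFamOn_smul_comp [T2Space E] [IsTopologicalAddGroup E]
    [ContinuousSMul ℝ E] [LocallyConvexSpace ℝ E] {ι : Type*} [Fintype ι] (b : Module.Basis ι ℝ V)
    [FiniteDimensional ℝ V] {Ω : Set (Y × V)} (hΩ : IsOpen Ω) {D : Set (Y → V → E)}
    (hD : DerivClosed b Ω D) {g : Y → V → E} (hg : g ∈ D)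
    {V' : Type*} [NormedAddCommGroup V'] [NormedSpace ℝ V'] {W : Set V'} (hW : IsOpen W)
    {ψ : V' → V} (hψ : ContDiffOn ℝ ∞ ψ W) {c : V' → ℝ} (hc : ContDiffOn ℝ ∞ c W)
    {Ω' : Set (Y × V')} (hΩ' : IsOpen Ω') (hm : ∀ p ∈ Ω', p.2 ∈ W ∧ (p.1, ψ p.2) ∈ Ω) :
    SmoothFamOn (fun y x => c x • g y (ψ x)) Ω' := by
  -- The derivative of `c • (g ∘ ψ)` along `v` is `∂_v c • (g ∘ ψ) + ∑ c (∂_v ψ)_i • (∂_i g ∘ ψ)`.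
  -- Sums of such products are therefore stable under derivatives, whence the additive closure of
  -- `G`.
  let G : Set (Y → V' → E) := {h | ∃ (c : V' → ℝ) (g : Y → V → E), ContDiffOn ℝ ∞ c W ∧ g ∈ D ∧
    h = fun y x => c x • g y (ψ x)}
  have hcont : ∀ (c : V' → ℝ) (g : Y → V → E), ContDiffOn ℝ ∞ c W → g ∈ D →
      ContinuousOn (fun p : Y × V' => c p.2 • g p.1 (ψ p.2)) Ω' := by
    intro c g hc hg
    refine ContinuousOn.smul (hc.continuousOn.comp continuousOn_snd fun p hp => (hm p hp).1) ?_
    exact (hD g hg).1.comp (f := fun p : Y × V' => (p.1, ψ p.2)) (continuousOn_fst.prodMk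
      (hψ.continuousOn.comp continuousOn_snd fun p hp => (hm p hp).1)) fun p hp => (hm p hp).2
  have hmem : (fun y x => c x • g y (ψ x)) ∈ G := ⟨c, g, hc, hg, rfl⟩
  refine DerivClosed.smoothFamOn (D := AddSubmonoid.closure G) hΩ' ?_
    (AddSubmonoid.subset_closure hmem)
  intro h hh
  refine ⟨?_, fun v => ?_⟩
  · induction hh using AddSubmonoid.closure_induction with
    | mem h hh =>
      obtain ⟨c, g, hc, hg, rfl⟩ := hh
      exact hcont c g hc hg
    | zero => exact continuousOn_const
    | add h₁ h₂ _ _ ih₁ ih₂ => exact ih₁.add ih₂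
  · induction hh using AddSubmonoid.closure_induction with
    | mem h hh =>
      obtain ⟨c, g, hc, hg, rfl⟩ := hh
      choose g' hg' hlim using (hD g hg).2
      have hψ' : ContDiffOn ℝ ∞ (fun x => fderiv ℝ ψ x v) W :=
        (hψ.fderiv_of_isOpen hW (m := ∞) (by simp)).clm_apply contDiffOn_const
      have hc' : ContDiffOn ℝ ∞ (fun x => fderiv ℝ c x v) W :=
        (hc.fderiv_of_isOpen hW (m := ∞) (by simp)).clm_apply contDiffOn_const
      have hcoord : ∀ i, ContDiffOn ℝ ∞ (fun x => c x * b.repr (fderiv ℝ ψ x v) i) W := fun i =>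
        hc.mul ((LinearMap.toContinuousLinearMap (b.coord i)).contDiff.comp_contDiffOn hψ')
      refine ⟨(fun y x => fderiv ℝ c x v • g y (ψ x)) +
        ∑ i, fun y x => (c x * b.repr (fderiv ℝ ψ x v) i) • g' i y (ψ x),
        add_mem (AddSubmonoid.subset_closure ⟨_, g, hc', hg, rfl⟩)
          (sum_mem fun i _ => AddSubmonoid.subset_closure ⟨_, g' i, hcoord i, hg' i, rfl⟩),
        fun p hp => ?_⟩
      obtain ⟨hpW, hpΩ⟩ := hm p hp
      have hcd : HasLineDerivAt ℝ c (fderiv ℝ c p.2 v) p.2 v :=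
        (((hc.contDiffAt (hW.mem_nhds hpW)).differentiableAt
          (by simp)).hasFDerivAt.hasLineDerivAt v)
      have hψd : HasLineDerivAt ℝ ψ (fderiv ℝ ψ p.2 v) p.2 v :=
        (((hψ.contDiffAt (hW.mem_nhds hpW)).differentiableAt
          (by simp)).hasFDerivAt.hasLineDerivAt v)
      have hcomp := tendsto_comp_of_partial b (hΩ.slice p.1) (g := g p.1)
        (g' := fun i => g' i p.1) hpΩ
        (fun i => ContinuousAt.comp (f := fun x : V => (p.1, x))
          (g := fun q : Y × V => g' i q.1 q.2)
          ((hD _ (hg' i)).1.continuousAt (hΩ.mem_nhds hpΩ)) (by fun_prop))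
        (fun i z hz => hlim i (p.1, z) hz) hψd.tendsto_slope_zero
      -- In the product rule the slope of `c` multiplies `g ∘ ψ` at the displaced point, so
      -- continuity along the line is required.
      have hval' : Tendsto (fun t : ℝ => g p.1 (ψ (p.2 + t • v))) (𝓝[≠] 0)
          (𝓝 (g p.1 (ψ p.2))) := by
        have h1 : ContinuousAt (fun q : Y × V' => (1 : ℝ) • g q.1 (ψ q.2)) p :=
          (hcont (fun _ => 1) g contDiffOn_const hg).continuousAt (hΩ'.mem_nhds hp)
        simp only [one_smul] at h1
        have h2 : Tendsto (fun t : ℝ => (p.1, p.2 + t • v)) (𝓝[≠] 0) (𝓝 p) := by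
          have h3 : Continuous fun t : ℝ => (p.1, p.2 + t • v) := by fun_prop
          have := h3.tendsto 0
          rw [zero_smul, add_zero] at this
          exact this.mono_left nhdsWithin_le_nhds
        exact h1.tendsto.comp h2
      have hsum := (hcd.tendsto_slope_zero.smul hval').add (hcomp.const_smul (c p.2))
      convert hsum using 1
      · funext t
        simp only [diffQuot, smul_smul, smul_sub, smul_eq_mul, id_eq]
        rw [mul_sub, sub_smul, mul_comm (c p.2) t⁻¹]
        abel
      · congr 1
        simp only [Pi.add_apply, Finset.sum_apply, Finset.smul_sum, smul_smul]
    | zero =>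
      refine ⟨0, zero_mem _, fun p _ => ?_⟩
      change Tendsto (diffQuot (fun _ => 0) v p.2) _ _
      rw [diffQuot_const]
      exact tendsto_const_nhds
    | add h₁ h₂ _ _ ih₁ ih₂ =>
      obtain ⟨h₁', hm₁, hl₁⟩ := ih₁
      obtain ⟨h₂', hm₂, hl₂⟩ := ih₂
      refine ⟨h₁' + h₂', add_mem hm₁ hm₂, fun p hp =>
        ((hl₁ p hp).add (hl₂ p hp)).congr fun t => ?_⟩
      simp only [diffQuot, ← smul_add, Pi.add_apply]
      congr 1
      abel

/-- Pullbacks of smooth families along smooth maps, multiplied with smooth functions, are smooth. -/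
theorem SmoothFamOn.smul_comp [T2Space E] [IsTopologicalAddGroup E]
    [ContinuousSMul ℝ E] [LocallyConvexSpace ℝ E] [FiniteDimensional ℝ V]
    {Ω : Set (Y × V)} {g : Y → V → E} (hg : SmoothFamOn g Ω) (hΩ : IsOpen Ω)
    {V' : Type*} [NormedAddCommGroup V'] [NormedSpace ℝ V'] {W : Set V'} (hW : IsOpen W)
    {ψ : V' → V} (hψ : ContDiffOn ℝ ∞ ψ W) {c : V' → ℝ} (hc : ContDiffOn ℝ ∞ c W)
    {Ω' : Set (Y × V')} (hΩ' : IsOpen Ω') (hm : ∀ p ∈ Ω', p.2 ∈ W ∧ (p.1, ψ p.2) ∈ Ω) :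
    SmoothFamOn (fun y x => c x • g y (ψ x)) Ω' :=
  (hg.derivClosed (Module.finBasis ℝ V)).smoothFamOn_smul_comp (Module.finBasis ℝ V) hΩ
    ⟨[], rfl⟩ hW hψ hc hΩ' hm

theorem SmoothFamOn.comp [T2Space E] [IsTopologicalAddGroup E]
    [ContinuousSMul ℝ E] [LocallyConvexSpace ℝ E] [FiniteDimensional ℝ V]
    {Ω : Set (Y × V)} {g : Y → V → E} (hg : SmoothFamOn g Ω) (hΩ : IsOpen Ω)
    {V' : Type*} [NormedAddCommGroup V'] [NormedSpace ℝ V'] {W : Set V'} (hW : IsOpen W)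
    {ψ : V' → V} (hψ : ContDiffOn ℝ ∞ ψ W)
    {Ω' : Set (Y × V')} (hΩ' : IsOpen Ω') (hm : ∀ p ∈ Ω', p.2 ∈ W ∧ (p.1, ψ p.2) ∈ Ω) :
    SmoothFamOn (fun y x => g y (ψ x)) Ω' := by
  have h := hg.smul_comp hΩ hW hψ (c := fun _ => (1 : ℝ)) contDiffOn_const hΩ' hm
  simpa only [one_smul] using h

/-- Directional derivatives of a smooth function may be taken in any order. -/
theorem SmoothOn.iterDeriv_dirDeriv [T2Space E] [IsTopologicalAddGroup E]
    [ContinuousSMul ℝ E] [LocallyConvexSpace ℝ E] {U : Set V} (hU : IsOpen U)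
    {f : V → E} (hf : SmoothOn f U) (v : V) (vs : List V) :
    EqOn (iterDeriv (dirDeriv f v) vs) (iterDeriv f (v :: vs)) U := by
  induction vs with
  | nil => exact fun _ _ => rfl
  | cons w vs ih =>
    intro x hx
    have h1 : iterDeriv (dirDeriv f v) (w :: vs) x = iterDeriv f (w :: v :: vs) x :=
      iterDeriv_congr hU ih [w] hx
    rw [h1]
    have ht : ∀ us u, ∀ z ∈ U, Tendsto (diffQuot (iterDeriv f us) u z) (𝓝[≠] 0)
        (𝓝 (iterDeriv f (u :: us) z)) := fun us u z hz => hf.tendsto us u hz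
    have hat : ∀ us : List V, ContinuousAt (iterDeriv f us) x := fun us =>
      (hf us).1.continuousAt (hU.mem_nhds hx)
    -- The induction has brought `v` next to `w`; the swap moves it past `w` to the outermost place.
    exact diffQuot_swap (g := iterDeriv f vs) (gv := iterDeriv f (w :: vs))
      (gw := iterDeriv f (v :: vs)) (gvw := iterDeriv f (w :: v :: vs))
      (gwv := iterDeriv f (v :: w :: vs)) hU hx (ht vs w) (ht vs v) (ht (v :: vs) w)
      (ht (w :: vs) v) (hat _) (hat _)

end Family

/-! ### The smooth compact open topology -/

namespace SmoothMap

section Topology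

variable {V : Type*} [NormedAddCommGroup V] [NormedSpace ℝ V]
variable {M : Type*} [TopologicalSpace M] [ChartedSpace V M]
variable {E : Type*} [AddCommGroup E] [Module ℝ E] [TopologicalSpace E]
variable {Y : Type*} [TopologicalSpace Y]

/-- Evaluation is jointly continuous for the compact-open topology because chart images are locally
compact; this is where finite dimension enters. -/
lemma continuous_chartDeriv_apply [FiniteDimensional ℝ V] (φ : atlas V M) (vs : List V) :
    Continuous fun p : SmoothMap V M E × φ.1.target => chartDeriv φ vs p.1 p.2 := by
  have : ProperSpace V := FiniteDimensional.proper ℝ V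
  have : LocallyCompactSpace φ.1.target := φ.1.open_target.locallyCompactSpace
  exact ((continuous_chartDeriv φ vs).comp continuous_fst).eval continuous_snd

/-- The local representatives of smooth maps depend smoothly on the point and continuously on the
map. -/
theorem smoothFamOn [FiniteDimensional ℝ V] {φ : OpenPartialHomeomorph M V} (hφ : φ ∈ atlas V M) :
    SmoothFamOn (fun (f : SmoothMap V M E) (x : V) => f (φ.symm x)) (univ ×ˢ φ.target) := by
  refine fun vs => ⟨?_, fun v p hp => (p.1.smooth φ hφ vs).2 v p.2 hp.2⟩
  rw [continuousOn_iff_continuous_domRestrict]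
  exact (continuous_chartDeriv_apply ⟨φ, hφ⟩ vs).comp
    (f := fun p : (univ ×ˢ φ.target : Set (SmoothMap V M E × V)) => (p.1.1, ⟨p.1.2, p.2.2⟩))
    (by fun_prop)

/-- A map into the space of smooth maps is continuous if its local representatives are smooth
families. -/
theorem continuous_of_smoothFamOn {F : Y → SmoothMap V M E}
    (h : ∀ φ ∈ atlas V M, SmoothFamOn (fun y x => F y (φ.symm x)) (univ ×ˢ φ.target)) :
    Continuous F := by
  refine continuous_iff.2 fun φ vs => ContinuousMap.continuous_of_continuous_uncurry _ ?_
  exact (h φ.1 φ.2 vs).1.comp_continuous (f := fun p : Y × φ.1.target => (p.1, (p.2 : V)))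
    (by fun_prop) fun p => ⟨mem_univ _, p.2.2⟩

end Topology

/-! ### Independence of the choice of charts -/

section ChangeOfCharts

variable {V : Type*} [NormedAddCommGroup V] [NormedSpace ℝ V] [FiniteDimensional ℝ V]
variable {M : Type*} [TopologicalSpace M] [ChartedSpace V M] [IsManifold 𝓘(ℝ, V) ∞ M]
variable {E : Type*} [AddCommGroup E] [Module ℝ E] [TopologicalSpace E] [T2Space E]
  [IsTopologicalAddGroup E] [ContinuousSMul ℝ E] [LocallyConvexSpace ℝ E]
variable {Y : Type*} [TopologicalSpace Y]

lemma contDiffOn_transition {V : Type*} [NormedAddCommGroup V] [NormedSpace ℝ V]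
    {M : Type*} [TopologicalSpace M] [ChartedSpace V M] [IsManifold 𝓘(ℝ, V) ∞ M]
    {φ φ' : OpenPartialHomeomorph M V} (hφ : φ ∈ atlas V M)
    (hφ' : φ' ∈ atlas V M) :
    ContDiffOn ℝ ∞ (fun x => φ' (φ.symm x)) (φ.symm.trans φ').source := by
  rw [← contMDiffOn_iff_contDiffOn]
  have h1 := contMDiffOn_of_mem_maximalAtlas (I := 𝓘(ℝ, V)) (n := ∞)
    (IsManifold.subset_maximalAtlas hφ')
  have h2 := contMDiffOn_symm_of_mem_maximalAtlas (I := 𝓘(ℝ, V)) (n := ∞)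
    (IsManifold.subset_maximalAtlas hφ)
  refine h1.comp (h2.mono fun x hx => ?_) fun x hx => ?_
  · rw [OpenPartialHomeomorph.trans_source] at hx
    exact hx.1
  · rw [OpenPartialHomeomorph.trans_source] at hx
    exact hx.2

/-- Smoothness of the local representatives in charts around each point suffices. -/
theorem smoothFamOn_chart {h : Y → M → E} {φ : OpenPartialHomeomorph M V} (hφ : φ ∈ atlas V M)
    (H : ∀ x ∈ φ.target, ∃ φ' ∈ atlas V M, φ.symm x ∈ φ'.source ∧
      SmoothFamOn (fun y z => h y (φ'.symm z)) (univ ×ˢ φ'.target)) :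
    SmoothFamOn (fun y x => h y (φ.symm x)) (univ ×ˢ φ.target) := by
  refine SmoothFamOn.of_locally fun p hp => ?_
  obtain ⟨φ', hφ', hx, hfam⟩ := H p.2 hp.2
  have ho : IsOpen ((univ : Set Y) ×ˢ (φ.symm.trans φ').source) :=
    isOpen_univ.prod (φ.symm.trans φ').open_source
  have hsrc : ∀ x, x ∈ (φ.symm.trans φ').source ↔ x ∈ φ.target ∧ φ.symm x ∈ φ'.source := by
    intro x
    simp
  refine ⟨univ ×ˢ (φ.symm.trans φ').source, ho, ⟨mem_univ _, (hsrc _).2 ⟨hp.2, hx⟩⟩, ?_⟩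
  refine (hfam.comp (isOpen_univ.prod φ'.open_target) (φ.symm.trans φ').open_source
    (contDiffOn_transition hφ hφ') ho fun q hq => ⟨hq.2, mem_univ _, ?_⟩).congr ho fun q hq => ?_
  · exact φ'.map_source ((hsrc _).1 hq.2).2
  · simp only [φ'.left_inv ((hsrc _).1 hq.2).2]

end ChangeOfCharts

end SmoothMap

/-! ### Metrizability and completeness of `C^∞(M, E)` -/

section Limits

variable {V : Type*} [NormedAddCommGroup V] [NormedSpace ℝ V]
variable {E : Type*} [AddCommGroup E] [Module ℝ E] [TopologicalSpace E]
  [IsTopologicalAddGroup E] [ContinuousSMul ℝ E] [LocallyConvexSpace ℝ E]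

/-- A limit of functions whose directional derivatives converge locally uniformly is
differentiable. -/
theorem tendsto_diffQuot_of_limit {X : Type*} {l : Filter X} [l.NeBot] {F F' : X → V → E}
    {g : V → E} {U : Set V} (hU : IsOpen U) {v z : V} (hz : z ∈ U) {e : E}
    (hF : ∀ i, ∀ x ∈ U, Tendsto (diffQuot (F i) v x) (𝓝[≠] 0) (𝓝 (F' i x)))
    (hg : ∀ x ∈ U, Tendsto (fun i => F i x) l (𝓝 (g x)))
    (he : Tendsto (fun p : X × V => F' p.1 p.2) (l ×ˢ 𝓝 z) (𝓝 e)) :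
    Tendsto (diffQuot g v z) (𝓝[≠] 0) (𝓝 e) := by
  intro N hN
  obtain ⟨C, hC, hCc, hCconv, hCN⟩ := exists_isClosed_convex_nhds_subset hN
  obtain ⟨S, hS, B, hB, hSB⟩ := mem_prod_iff.1 (he hC)
  obtain ⟨r, hr, hrB⟩ := Metric.mem_nhds_iff.1 (inter_mem hB (hU.mem_nhds hz))
  have hcont : Continuous fun t : ℝ => |t| * ‖v‖ := by fun_prop
  have hev : ∀ᶠ t in 𝓝 (0 : ℝ), |t| * ‖v‖ < r :=
    hcont.continuousAt.eventually_lt continuousAt_const (by simpa using hr)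
  rw [mem_map]
  filter_upwards [self_mem_nhdsWithin, nhdsWithin_le_nhds hev] with t ht0 ht
  have key : ∀ s ∈ Icc (0 : ℝ) 1, z + (s * t) • v ∈ B ∩ U := by
    intro s hs
    apply hrB
    rw [Metric.mem_ball, dist_eq_norm, add_sub_cancel_left, norm_smul, norm_mul, Real.norm_eq_abs,
      Real.norm_eq_abs, abs_of_nonneg hs.1]
    refine lt_of_le_of_lt ?_ ht
    gcongr
    exact mul_le_of_le_one_left (abs_nonneg _) hs.2
  have hzt : z + t • v ∈ U := by simpa using (key 1 (by simp)).2
  apply hCN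
  -- At fixed `t` the quotient of `g` is a limit of quotients of the `F i`, which eventually lie in
  -- the closed set `C` by the mean value theorem.
  have hlim : Tendsto (fun i => diffQuot (F i) v z t) l (𝓝 (diffQuot g v z t)) :=
    ((hg _ hzt).sub (hg _ hz)).const_smul _
  refine hCc.mem_of_tendsto hlim ?_
  filter_upwards [hS] with i hi
  exact hCconv.diffQuot_mem hCc ht0 (fun s hs => hF i _ (key s hs).2)
    fun s hs => hSB (mk_mem_prod hi (key s hs).1)

end Limits

namespace SmoothMap

section Frechet

variable {V : Type*} [NormedAddCommGroup V] [NormedSpace ℝ V] [FiniteDimensional ℝ V]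
variable {M : Type*} [TopologicalSpace M] [ChartedSpace V M]
variable {E : Type*} [AddCommGroup E] [Module ℝ E] [TopologicalSpace E] [T2Space E]
  [IsTopologicalAddGroup E] [ContinuousSMul ℝ E] [LocallyConvexSpace ℝ E]

/-- The continuity of a map into `C^∞(M, E)` can be tested on charts covering `M` and on iterated
partial derivatives along a basis. -/
theorem continuous_of_cover [IsManifold 𝓘(ℝ, V) ∞ M] {ι : Type*} [Fintype ι]
    (b : Module.Basis ι ℝ V) {s : Set M} (hs : ⋃ m ∈ s, (chartAt V m).source = univ)
    {Y : Type*} [TopologicalSpace Y] {F : Y → SmoothMap V M E}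
    (hF : ∀ m ∈ s, ∀ is : List ι,
      Continuous fun y => chartDeriv ⟨chartAt V m, chart_mem_atlas V m⟩ (is.map b) (F y)) :
    Continuous F := by
  have : ProperSpace V := FiniteDimensional.proper ℝ V
  refine continuous_of_smoothFamOn fun φ hφ => smoothFamOn_chart (h := fun y m => F y m) hφ
    fun x hx => ?_
  obtain ⟨m, hm, hxm⟩ := mem_iUnion₂.1 (hs ▸ mem_univ (φ.symm x))
  refine ⟨chartAt V m, chart_mem_atlas V m, hxm, ?_⟩
  have ho : IsOpen ((univ : Set Y) ×ˢ (chartAt V m).target) :=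
    isOpen_univ.prod (chartAt V m).open_target
  have hD : DerivClosed b ((univ : Set Y) ×ˢ (chartAt V m).target)
      (range fun (is : List ι) (y : Y) =>
        iterDeriv (fun z => F y ((chartAt V m).symm z)) (is.map b)) := by
    rintro _ ⟨is, rfl⟩
    refine ⟨?_, fun i => ⟨_, ⟨i :: is, rfl⟩, fun p hp => ?_⟩⟩
    · rw [continuousOn_iff_continuous_domRestrict]
      have : LocallyCompactSpace (chartAt V m).target :=
        (chartAt V m).open_target.locallyCompactSpace
      have h1 : Continuous fun p : Y × (chartAt V m).target =>
          chartDeriv ⟨chartAt V m, chart_mem_atlas V m⟩ (is.map b) (F p.1) p.2 :=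
        ((hF m hm is).comp continuous_fst).eval continuous_snd
      exact h1.comp (f := fun p : ((univ : Set Y) ×ˢ (chartAt V m).target : Set (Y × V)) =>
        (p.1.1, ⟨p.1.2, p.2.2⟩)) (by fun_prop)
    · exact ((F p.1).smooth _ (chart_mem_atlas V m)).tendsto _ (b i) hp.2
  -- Pulling back along the identity upgrades derivatives along the basis to derivatives along all
  -- vectors.
  have h := hD.smoothFamOn_smul_comp b ho ⟨[], rfl⟩ (chartAt V m).open_target (ψ := fun x => x)
    contDiffOn_id (c := fun _ => (1 : ℝ)) contDiffOn_const ho fun p hp => ⟨hp.2, hp⟩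
  simp only [one_smul] at h
  exact h

/-- The defining family of derivatives is uncountable, but countably many charts cover `M` and words
in a finite basis are countable. By `continuous_of_cover` these already induce the topology, which
thus embeds in a countable product of metrizable spaces. -/
theorem metrizableSpace [IsManifold 𝓘(ℝ, V) ∞ M] [SecondCountableTopology M]
    [TopologicalSpace.MetrizableSpace E] :
    TopologicalSpace.MetrizableSpace (SmoothMap V M E) := by
  have : ProperSpace V := FiniteDimensional.proper ℝ V
  let _ : MetricSpace E := TopologicalSpace.metrizableSpaceMetric E
  obtain ⟨s, hsc, hs⟩ := TopologicalSpace.countable_cover_nhds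
    (fun m : M => (chartAt V m).open_source.mem_nhds (mem_chart_source V m))
  have : Countable s := hsc.to_subtype
  let b := Module.finBasis ℝ V
  let Φ : SmoothMap V M E → ∀ p : s × List (Fin (Module.finrank ℝ V)),
      C((chartAt V (p.1 : M)).target, E) := fun f p =>
    chartDeriv ⟨chartAt V (p.1 : M), chart_mem_atlas V _⟩ (p.2.map b) f
  have hinj : Function.Injective Φ := by
    intro f g hfg
    ext m
    obtain ⟨m', hm', hmm'⟩ := mem_iUnion₂.1 (hs ▸ mem_univ m)
    have h := DFunLike.congr_fun (congrFun hfg (⟨m', hm'⟩, []))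
      ⟨chartAt V m' m, (chartAt V m').map_source hmm'⟩
    change f ((chartAt V m').symm (chartAt V m' m)) = g ((chartAt V m').symm (chartAt V m' m)) at h
    rwa [(chartAt V m').left_inv hmm'] at h
  have hΦ : IsInducing Φ := by
    refine ⟨le_antisymm ?_ ?_⟩
    · rw [← continuous_iff_le_induced]
      exact continuous_pi fun p => continuous_chartDeriv _ _
    · rw [← continuous_id_iff_le]
      let t : TopologicalSpace (SmoothMap V M E) := TopologicalSpace.induced Φ Pi.topologicalSpace
      refine continuous_of_cover (Y := SmoothMap V M E) b hs fun m hm is => ?_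
      have h : Continuous fun f : SmoothMap V M E => Φ f := continuous_induced_dom
      exact (continuous_pi_iff.1 h) (⟨m, hm⟩, is)
  have : ∀ p : s × List (Fin (Module.finrank ℝ V)),
      (uniformity C((chartAt V (p.1 : M)).target, E)).IsCountablyGenerated := by
    intro p
    have : LocallyCompactSpace (chartAt V (p.1 : M)).target :=
      (chartAt V (p.1 : M)).open_target.locallyCompactSpace
    have : SigmaCompactSpace (chartAt V (p.1 : M)).target :=
      sigmaCompactSpace_of_locallyCompact_secondCountable
    infer_instance
  have := UniformSpace.metrizableSpace
    (X := ∀ p : s × List (Fin (Module.finrank ℝ V)), C((chartAt V (p.1 : M)).target, E))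
  exact (⟨hΦ, hinj⟩ : IsEmbedding Φ).metrizableSpace

/-- All chart derivatives together embed `C^∞(M, E)` in a complete product, and the range is closed
because locally uniform limits commute with directional derivatives. No countability is needed,
since filters replace sequences. -/
theorem completeSpace (hE : @CompleteSpace E (IsTopologicalAddGroup.rightUniformSpace E)) :
    @CompleteSpace (SmoothMap V M E)
      (IsTopologicalAddGroup.rightUniformSpace (SmoothMap V M E)) := by
  have : ProperSpace V := FiniteDimensional.proper ℝ V
  let _ : UniformSpace E := IsTopologicalAddGroup.rightUniformSpace E
  have : IsUniformAddGroup E := isUniformAddGroup_of_addCommGroup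
  let _ : UniformSpace (SmoothMap V M E) := IsTopologicalAddGroup.rightUniformSpace _
  have : IsUniformAddGroup (SmoothMap V M E) := isUniformAddGroup_of_addCommGroup
  have hlc : ∀ φ : atlas V M, LocallyCompactSpace φ.1.target := fun φ =>
    φ.1.open_target.locallyCompactSpace
  have : ∀ p : atlas V M × List V, IsUniformAddGroup C(p.1.1.target, E) := by
    intro p
    have hu := ContinuousMap.isUniformEmbedding_toUniformOnFunIsCompact
      (α := p.1.1.target) (β := E)
    refine ⟨hu.isUniformInducing.uniformContinuous_iff.2 ?_⟩
    exact (hu.uniformContinuous.comp uniformContinuous_fst).sub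
      (hu.uniformContinuous.comp uniformContinuous_snd)
  let Φ : SmoothMap V M E →+ ∀ p : atlas V M × List V, C(p.1.1.target, E) :=
    AddMonoidHom.mk' (fun f p => chartDeriv p.1 p.2 f)
      fun f g => funext fun p => chartDeriv_add f g p.1 p.2
  have hΦ : IsInducing Φ := by
    refine ⟨?_⟩
    change (⨅ p : atlas V M × List V, _) = TopologicalSpace.induced Φ Pi.topologicalSpace
    rw [Pi.topologicalSpace, induced_iInf]
    refine iInf_congr fun p => ?_
    rw [induced_compose]
    rfl
  have hinj : Function.Injective Φ := by
    intro f g hfg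
    ext m
    have h := DFunLike.congr_fun
      (congrFun hfg (⟨chartAt V m, chart_mem_atlas V m⟩, []))
      ⟨chartAt V m m, mem_chart_target V m⟩
    change f ((chartAt V m).symm (chartAt V m m)) = g ((chartAt V m).symm (chartAt V m m)) at h
    rwa [(chartAt V m).left_inv (mem_chart_source V m)] at h
  rw [completeSpace_iff_isComplete_range (AddMonoidHom.isUniformInducing_of_isInducing hΦ)]
  refine IsClosed.isComplete (isClosed_of_closure_subset fun h hh => ?_)
  -- Smooth maps all of whose chart derivatives approach the components of `h`.
  let l : Filter (SmoothMap V M E) := comap Φ (𝓝 h)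
  have : l.NeBot := by
    rw [comap_neBot_iff]
    intro t ht
    obtain ⟨_, hx, f, rfl⟩ := mem_closure_iff_nhds.1 hh t ht
    exact ⟨f, hx⟩
  have hl : ∀ p, Tendsto (fun f : SmoothMap V M E => chartDeriv p.1 p.2 f) l (𝓝 (h p)) := fun p =>
    ((continuous_apply p).tendsto h).comp tendsto_comap
  have hpt : ∀ (φ : atlas V M) (vs : List V) (x : φ.1.target),
      Tendsto (fun f : SmoothMap V M E => chartDeriv φ vs f x) l (𝓝 (h (φ, vs) x)) :=
    fun φ vs x => ((continuous_eval_const (F := C(φ.1.target, E)) x).tendsto _).comp (hl (φ, vs))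
  let f₀ : M → E := fun m => h (⟨chartAt V m, chart_mem_atlas V m⟩, [])
    ⟨chartAt V m m, mem_chart_target V m⟩
  have hf₀ : ∀ m, Tendsto (fun f : SmoothMap V M E => f m) l (𝓝 (f₀ m)) := by
    intro m
    refine (hpt ⟨chartAt V m, chart_mem_atlas V m⟩ []
      ⟨chartAt V m m, mem_chart_target V m⟩).congr fun f => ?_
    change f ((chartAt V m).symm (chartAt V m m)) = f m
    rw [(chartAt V m).left_inv (mem_chart_source V m)]
  classical
  -- The value `0` off the chart image is a dummy; only points of the image are used.
  have key : ∀ φ : atlas V M, SmoothOn (fun x => f₀ (φ.1.symm x)) φ.1.target ∧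
      ∀ vs, EqOn (iterDeriv (fun x => f₀ (φ.1.symm x)) vs)
        (fun x => if hx : x ∈ φ.1.target then h (φ, vs) ⟨x, hx⟩ else 0) φ.1.target := by
    intro φ
    refine SmoothOn.of_family φ.1.open_target
      (fun vs x => if hx : x ∈ φ.1.target then h (φ, vs) ⟨x, hx⟩ else 0) ?_ ?_ ?_
    · intro x hx
      simp only [hx, dite_true]
      exact tendsto_nhds_unique (hpt φ [] ⟨x, hx⟩) (hf₀ (φ.1.symm x))
    · intro vs
      rw [continuousOn_iff_continuous_domRestrict]
      refine (h (φ, vs)).continuous.congr fun x => ?_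
      simp
    · intro vs v x hx
      refine tendsto_diffQuot_of_limit (l := l)
        (F := fun f => iterDeriv (fun x => f (φ.1.symm x)) vs)
        (F' := fun f => iterDeriv (fun x => f (φ.1.symm x)) (v :: vs)) φ.1.open_target hx
        (fun f z hz => (f.smoothOn φ).tendsto vs v hz) ?_ ?_
      · intro z hz
        simp only [hz, dite_true]
        exact hpt φ vs ⟨z, hz⟩
      · simp only [hx, dite_true]
        have := hlc φ
        have h1 : Tendsto (fun p : SmoothMap V M E × φ.1.target => chartDeriv φ (v :: vs) p.1 p.2)
            (l ×ˢ 𝓝 ⟨x, hx⟩) (𝓝 (h (φ, v :: vs) ⟨x, hx⟩)) := by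
          have h2 : Continuous fun q : C(φ.1.target, E) × φ.1.target => q.1 q.2 := by fun_prop
          have h3 := h2.tendsto (h (φ, v :: vs), ⟨x, hx⟩)
          rw [nhds_prod_eq] at h3
          exact h3.comp ((hl (φ, v :: vs)).prodMap tendsto_id)
        have h4 : l ×ˢ 𝓝 x = map (Prod.map id Subtype.val) (l ×ˢ 𝓝 (⟨x, hx⟩ : φ.1.target)) := by
          rw [← prod_map_map_eq', map_id, map_nhds_subtype_val,
            φ.1.open_target.nhdsWithin_eq hx]
        rw [h4, tendsto_map'_iff]
        exact h1
  refine ⟨⟨f₀, fun φ hφ => (key ⟨φ, hφ⟩).1⟩, ?_⟩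
  funext p
  ext x
  refine ((key p.1).2 p.2 x.2).trans ?_
  simp

end Frechet

end SmoothMap

/-- The smooth functions on a manifold with values in a Fréchet algebra form a Fréchet algebra. -/
theorem SmoothMap.frechetAlgebra {V : Type*} [NormedAddCommGroup V] [NormedSpace ℝ V]
    [FiniteDimensional ℝ V] {M : Type*} [TopologicalSpace M] [ChartedSpace V M]
    [IsManifold 𝓘(ℝ, V) ∞ M] [SecondCountableTopology M]
    {A : Type*} [Ring A] [Algebra ℝ A] [TopologicalSpace A] [FrechetAlgebra A] :
    FrechetAlgebra (SmoothMap V M A) where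
  metrizable :=
    have := FrechetAlgebra.metrizable (A := A)
    SmoothMap.metrizableSpace
  complete := SmoothMap.completeSpace FrechetAlgebra.complete

/-! ### The exponential law -/

section Slices

variable {P : Type*} [NormedAddCommGroup P] [NormedSpace ℝ P]
variable {V : Type*} [NormedAddCommGroup V] [NormedSpace ℝ V]
variable {E : Type*} [AddCommGroup E] [Module ℝ E] [TopologicalSpace E]

lemma dirDeriv_slice_left (f : P × V → E) (v : P) (p : P) (x : V) :
    dirDeriv (fun p => f (p, x)) v p = dirDeriv f (v, 0) (p, x) := by
  have : diffQuot (fun p => f (p, x)) v p = diffQuot f (v, 0) (p, x) := by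
    funext t
    simp [diffQuot]
  rw [dirDeriv, dirDeriv, this]

lemma dirDeriv_slice_right (f : P × V → E) (v : V) (p : P) (x : V) :
    dirDeriv (fun x => f (p, x)) v x = dirDeriv f (0, v) (p, x) := by
  have : diffQuot (fun x => f (p, x)) v x = diffQuot f (0, v) (p, x) := by
    funext t
    simp [diffQuot]
  rw [dirDeriv, dirDeriv, this]

lemma iterDeriv_slice_right (f : P × V → E) (vs : List V) (p : P) :
    iterDeriv (fun x => f (p, x)) vs =
      fun x => iterDeriv f (vs.map fun v => ((0, v) : P × V)) (p, x) := by
  induction vs with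
  | nil => rfl
  | cons v vs ih =>
    funext x
    simp only [iterDeriv, List.map_cons, ih, dirDeriv_slice_right]

/-- Turns the variable in `P` from a differentiated one into a parameter: derivatives of a slice are
derivatives along the vectors `(0, v)`. -/
lemma SmoothFamOn.slice {Y : Type*} [TopologicalSpace Y] {g : Y → P × V → E}
    {Ω : Set (Y × (P × V))} (hg : SmoothFamOn g Ω) :
    SmoothFamOn (fun (q : Y × P) x => g q.1 (q.2, x)) {r | (r.1.1, (r.1.2, r.2)) ∈ Ω} := by
  refine fun vs => ⟨?_, fun v q hq => ?_⟩
  · simp only [iterDeriv_slice_right]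
    exact (hg _).1.comp (f := fun r : (Y × P) × V => (r.1.1, (r.1.2, r.2)))
      (by fun_prop) fun _ h => h
  · obtain ⟨e, he⟩ := (hg (vs.map fun v => ((0, v) : P × V))).2 (0, v) _ hq
    refine ⟨e, he.congr fun t => ?_⟩
    simp [diffQuot, iterDeriv_slice_right]

/-- At step `0` this is the locally uniform convergence of difference quotients. It turns
convergence of quotients in a function space into continuity in the step. -/
lemma continuousAt_diffQuot_prod [IsTopologicalAddGroup E] [ContinuousSMul ℝ E]
    [LocallyConvexSpace ℝ E] {g g' : V → E} {U : Set V} (hU : IsOpen U) {v : V}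
    (hg : ContinuousOn g U) (hg' : ContinuousOn g' U)
    (hd : ∀ z ∈ U, Tendsto (diffQuot g v z) (𝓝[≠] 0) (𝓝 (g' z))) {p : V × ℝ}
    (h1 : p.1 ∈ U) (h2 : p.1 + p.2 • v ∈ U) :
    ContinuousAt (fun p : V × ℝ => if p.2 = 0 then g' p.1 else diffQuot g v p.1 p.2) p := by
  obtain ⟨y, τ⟩ := p
  by_cases hτ : τ = 0
  · subst hτ
    have h := tendsto_diffQuot_prod hU h1 (hg'.continuousAt (hU.mem_nhds h1)) hd
    simpa [ContinuousAt] using h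
  · have hne : ∀ᶠ p : V × ℝ in 𝓝 (y, τ), p.2 ≠ 0 :=
      continuous_snd.continuousAt.eventually_ne hτ
    have hc : ContinuousAt (fun p : V × ℝ => p.2⁻¹ • (g (p.1 + p.2 • v) - g p.1)) (y, τ) := by
      refine ContinuousAt.smul (continuousAt_snd.inv₀ hτ) (ContinuousAt.sub ?_ ?_)
      · exact ContinuousAt.comp (f := fun p : V × ℝ => p.1 + p.2 • v)
          (hg.continuousAt (hU.mem_nhds h2)) (by fun_prop)
      · exact ContinuousAt.comp (f := fun p : V × ℝ => p.1)
          (hg.continuousAt (hU.mem_nhds h1)) (by fun_prop)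
    refine hc.congr ?_
    filter_upwards [hne] with p hp
    simp [hp, diffQuot]

end Slices

namespace SmoothMap

variable {P : Type*} [NormedAddCommGroup P] [NormedSpace ℝ P]
variable {V : Type*} [NormedAddCommGroup V] [NormedSpace ℝ V]
variable {M : Type*} [TopologicalSpace M] [ChartedSpace V M]
variable {E : Type*} [AddCommGroup E] [Module ℝ E] [TopologicalSpace E]
variable {Y : Type*} [TopologicalSpace Y]

/-- Families of functions on `P × M` which are smooth in the charts of `M`. -/
def JointlySmooth (V : Type*) [NormedAddCommGroup V] [NormedSpace ℝ V] [ChartedSpace V M]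
    (k : Y → P → M → E) : Prop :=
  ∀ φ ∈ atlas V M,
    SmoothFamOn (fun y (p : P × V) => k y p.1 (φ.symm p.2)) (univ ×ˢ (univ ×ˢ φ.target))

lemma JointlySmooth.smoothFamOn_slice {k : Y → P → M → E} (hk : JointlySmooth V k)
    {φ : OpenPartialHomeomorph M V} (hφ : φ ∈ atlas V M) :
    SmoothFamOn (fun (q : Y × P) x => k q.1 q.2 (φ.symm x)) (univ ×ˢ φ.target) :=
  (hk φ hφ).slice.mono fun _ hr => ⟨mem_univ _, mem_univ _, hr.2⟩

/-- The map into `C^∞(M, E)` given by a jointly smooth function. -/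
def JointlySmooth.curry {k : Y → P → M → E} (hk : JointlySmooth V k) (y : Y) (p : P) :
    SmoothMap V M E where
  toFun := k y p
  smooth _ hφ := (hk.smoothFamOn_slice hφ).smoothOn (y, p) fun _ hx => ⟨mem_univ _, hx⟩

lemma JointlySmooth.continuous_curry {k : Y → P → M → E} (hk : JointlySmooth V k) :
    Continuous fun q : Y × P => hk.curry q.1 q.2 :=
  continuous_of_smoothFamOn fun _φ hφ => hk.smoothFamOn_slice hφ

lemma JointlySmooth.dirDeriv {k : Y → P → M → E} (hk : JointlySmooth V k) (v : P) :
    JointlySmooth V fun y p m => dirDeriv (fun p => k y p m) v p := by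
  intro φ hφ
  have h := (hk φ hφ).dirDeriv (v, 0)
  have : ∀ y (p : P × V), _root_.dirDeriv (fun p' => k y p' (φ.symm p.2)) v p.1 =
      _root_.dirDeriv (fun p : P × V => k y p.1 (φ.symm p.2)) (v, 0) p := fun y p =>
    dirDeriv_slice_left (fun p : P × V => k y p.1 (φ.symm p.2)) v p.1 p.2
  simp only [this]
  exact h

section

variable [T2Space E] [IsTopologicalAddGroup E] [ContinuousSMul ℝ E] [LocallyConvexSpace ℝ E]

/-- The quotient, completed at `τ = 0` by the expected derivative, is a curve `Q` in `C^∞(M, E)`. In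
a chart its derivatives are completed quotients of derivatives of a function on `P × V`, so `Q` is
continuous. -/
lemma JointlySmooth.tendsto_diffQuot {k : Y → P → M → E} (hk : JointlySmooth V k) (v : P) (y : Y)
    (p : P) : Tendsto (diffQuot (hk.curry y) v p) (𝓝[≠] 0) (𝓝 ((hk.dirDeriv v).curry y p)) := by
  let Q : ℝ → SmoothMap V M E := fun τ =>
    if τ = 0 then (hk.dirDeriv v).curry y p else diffQuot (hk.curry y) v p τ
  have hQ : Continuous Q := by
    refine continuous_iff.2 fun φ vs => ContinuousMap.continuous_of_continuous_uncurry _ ?_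
    let f : P × V → E := fun q => k y q.1 (φ.1.symm q.2)
    let ws : List (P × V) := vs.map fun v => (0, v)
    have hU : IsOpen ((univ : Set P) ×ˢ φ.1.target) := isOpen_univ.prod φ.1.open_target
    have hf : SmoothOn f (univ ×ˢ φ.1.target) :=
      (hk φ.1 φ.2).smoothOn y fun x hx => ⟨mem_univ _, hx⟩
    have hQf : ∀ (τ : ℝ) (x : φ.1.target), chartDeriv φ vs (Q τ) x =
        (fun q : (P × V) × ℝ => if q.2 = 0 then iterDeriv f ((v, 0) :: ws) q.1 else
          diffQuot (iterDeriv f ws) (v, 0) q.1 q.2) ((p, (x : V)), τ) := by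
      intro τ x
      have hval : ∀ p', chartDeriv φ vs (hk.curry y p') x = iterDeriv f ws (p', x) := fun p' =>
        congrFun (iterDeriv_slice_right f vs p') x
      by_cases hτ : τ = 0
      · simp only [Q, hτ, if_true]
        have h1 : (fun x => _root_.dirDeriv (fun p => k y p (φ.1.symm x)) v p) =
            fun x => _root_.dirDeriv f (v, 0) (p, x) := funext fun x =>
          dirDeriv_slice_left f v p x
        change iterDeriv (fun x => _root_.dirDeriv (fun p => k y p (φ.1.symm x)) v p) vs x = _
        rw [h1, iterDeriv_slice_right (_root_.dirDeriv f (v, 0))]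
        -- Here the derivative in `P` was taken first and must be interchanged with those in the
        -- chart.
        exact hf.iterDeriv_dirDeriv hU (v, 0) ws ⟨mem_univ _, x.2⟩
      · simp only [Q, hτ, if_false, diffQuot]
        rw [chartDeriv_smul, sub_eq_add_neg, chartDeriv_add, chartDeriv_neg]
        simp only [ContinuousMap.smul_apply, ContinuousMap.add_apply, ContinuousMap.neg_apply, hval]
        simp [sub_eq_add_neg]
    have hc : Continuous fun q : ℝ × φ.1.target => chartDeriv φ vs (Q q.1) q.2 := by
      simp only [hQf]
      refine continuous_iff_continuousAt.2 fun q => ?_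
      exact ContinuousAt.comp (f := fun q : ℝ × φ.1.target => ((p, (q.2 : V)), q.1))
        (continuousAt_diffQuot_prod hU (hf ws).1 (hf ((v, 0) :: ws)).1
          (fun z hz => hf.tendsto ws (v, 0) hz) ⟨mem_univ _, q.2.2⟩
          ⟨mem_univ _, by simp⟩) (by fun_prop)
    exact hc
  have h := (hQ.tendsto 0).mono_left (nhdsWithin_le_nhds (s := {0}ᶜ))
  simp only [Q, if_true] at h
  refine h.congr' ?_
  filter_upwards [self_mem_nhdsWithin] with τ hτ
  have hτ : τ ≠ 0 := hτ
  simp [hτ]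

/-- A jointly smooth function on `P × M` gives a smooth function on `P` with values in
`C^∞(M, E)`. -/
theorem JointlySmooth.smoothFamOn {k : Y → P → M → E} (hk : JointlySmooth V k) :
    SmoothFamOn hk.curry univ := by
  refine DerivClosed.smoothFamOn isOpen_univ
    (D := {κ | ∃ (k : Y → P → M → E) (hk : JointlySmooth V k), κ = hk.curry}) ?_ ⟨k, hk, rfl⟩
  rintro _ ⟨k, hk, rfl⟩
  exact ⟨hk.continuous_curry.continuousOn, fun v => ⟨_, ⟨_, hk.dirDeriv v, rfl⟩,
    fun p _ => hk.tendsto_diffQuot v p.1 p.2⟩⟩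

/-- The evaluation of an iterated derivative at a point of a chart. -/
noncomputable def evalDeriv (φ : atlas V M) (vs : List V) (x : φ.1.target) :
    SmoothMap V M E →L[ℝ] E where
  toFun f := chartDeriv φ vs f x
  map_add' f g := by rw [chartDeriv_add, ContinuousMap.add_apply]
  map_smul' c f := by rw [chartDeriv_smul, ContinuousMap.smul_apply, RingHom.id_apply]
  cont := (continuous_eval_const (F := C(φ.1.target, E)) x).comp (continuous_chartDeriv φ vs)

variable [FiniteDimensional ℝ V]

/-- Smooth curves in `C^∞(M, E)` are smooth functions on `ℝ × M`. -/
theorem jointlySmooth_uncurry :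
    JointlySmooth V fun (F : SmoothMap ℝ ℝ (SmoothMap V M E)) (t : ℝ) (m : M) => F t m := by
  intro φ hφ
  have ho : IsOpen ((univ : Set (SmoothMap ℝ ℝ (SmoothMap V M E))) ×ˢ
      ((univ : Set ℝ) ×ˢ φ.target)) := isOpen_univ.prod (isOpen_univ.prod φ.open_target)
  let b : Module.Basis (Unit ⊕ Fin (Module.finrank ℝ V)) ℝ (ℝ × V) :=
    (Module.Basis.singleton Unit ℝ).prod (Module.finBasis ℝ V)
  have hb₁ : ∀ i, b (Sum.inl i) = (1, 0) := fun i => by simp [b, Module.Basis.prod_apply]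
  have hb₂ : ∀ i, b (Sum.inr i) = (0, Module.finBasis ℝ V i) := fun i => by
    simp [b, Module.Basis.prod_apply]
  have hrefl : OpenPartialHomeomorph.refl ℝ ∈ atlas ℝ ℝ := by simp
  -- Differentiate in time first, inside `C^∞(M, E)`, and then in space. Derivatives along the
  -- product basis preserve this shape.
  have hD : DerivClosed b ((univ : Set (SmoothMap ℝ ℝ (SmoothMap V M E))) ×ˢ
      ((univ : Set ℝ) ×ˢ φ.target))
      (range fun (l : List ℝ × List V) (F : SmoothMap ℝ ℝ (SmoothMap V M E)) (p : ℝ × V) =>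
        iterDeriv (fun x => iterDeriv F l.1 p.1 (φ.symm x)) l.2 p.2) := by
    rintro _ ⟨⟨ts, vs⟩, rfl⟩
    refine ⟨?_, ?_⟩
    · have h1 := (SmoothMap.smoothFamOn (E := SmoothMap V M E) hrefl ts).1
      have h2 := (SmoothMap.smoothFamOn (E := E) hφ vs).1
      refine h2.comp (f := fun q : SmoothMap ℝ ℝ (SmoothMap V M E) × (ℝ × V) =>
        (iterDeriv q.1 ts q.2.1, q.2.2)) ?_ fun q hq => ⟨mem_univ _, hq.2.2⟩
      refine ContinuousOn.prodMk ?_ (by fun_prop)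
      exact h1.comp (f := fun q : SmoothMap ℝ ℝ (SmoothMap V M E) × (ℝ × V) => (q.1, q.2.1))
        (by fun_prop) fun q _ => ⟨mem_univ _, mem_univ _⟩
    · rintro (i | i)
      · refine ⟨_, ⟨(1 :: ts, vs), rfl⟩, fun q hq => ?_⟩
        rw [hb₁]
        -- Evaluating a space derivative is continuous and linear, so a further time derivative
        -- passes through it.
        let L : SmoothMap V M E →L[ℝ] E := evalDeriv ⟨φ, hφ⟩ vs ⟨q.2.2, hq.2.2⟩
        have hF : SmoothOn q.1 univ := q.1.smooth _ hrefl
        refine ((L.continuous.tendsto _).comp (hF.tendsto ts 1 (mem_univ q.2.1))).congr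
          fun τ => ?_
        simp only [Function.comp_apply, diffQuot, map_smul, map_sub]
        simp only [Prod.smul_mk, smul_zero, Prod.fst_add, Prod.snd_add, add_zero]
        rfl
      · refine ⟨_, ⟨(ts, Module.finBasis ℝ V i :: vs), rfl⟩, fun q hq => ?_⟩
        rw [hb₂]
        refine (((iterDeriv q.1 ts q.2.1).smooth φ hφ).tendsto vs _ hq.2.2).congr fun τ => ?_
        simp only [diffQuot, Prod.smul_mk, smul_zero, Prod.fst_add, Prod.snd_add, add_zero]
        rfl
  have h := hD.smoothFamOn_smul_comp b ho ⟨([], []), rfl⟩ (isOpen_univ.prod φ.open_target)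
    (ψ := fun x => x) contDiffOn_id (c := fun _ => (1 : ℝ)) contDiffOn_const ho
    fun p hp => ⟨hp.2, hp⟩
  simp only [one_smul] at h
  exact h

end

end SmoothMap

/-! ### The evaluation map and its sections -/

/-- A smooth cut-off function, equal to `1` at `1` and to `0` near `0`, and its quotients. -/
lemma exists_cutoff : ∃ χ w ρ : ℝ → ℝ, ContDiff ℝ ∞ χ ∧ ContDiff ℝ ∞ w ∧ ContDiff ℝ ∞ ρ ∧
    χ 1 = 1 ∧ (∀ u, |u| < 1 / 2 → χ u = 0) ∧ (∀ u, |u| < 1 / 2 → w u = 0) ∧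
    (∀ u, χ u = u * w u) ∧ ∀ u, 1 - χ u = (1 - u) * ρ u := by
  -- Centre `1` and outer radius `1/2` force vanishing for `|u| < 1/2`; being `1` near `1` makes `(1
  -- - β u) / (1 - u)` smooth there.
  let β : ContDiffBump (1 : ℝ) := ⟨1 / 4, 1 / 2, by norm_num, by norm_num⟩
  have hβ : ContDiff ℝ ∞ β := β.contDiff
  have h0 : ∀ u : ℝ, |u| < 1 / 2 → β u = 0 := by
    intro u hu
    refine β.zero_of_le_dist ?_
    rw [Real.dist_eq, abs_sub_comm]
    change 1 / 2 ≤ _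
    have := (abs_lt.1 hu).2
    rw [abs_of_nonneg (by linarith)]
    linarith
  have h1 : ∀ u : ℝ, |u - 1| < 1 / 4 → β u = 1 := fun u hu =>
    β.one_of_mem_closedBall (by rw [Metric.mem_closedBall, Real.dist_eq]; exact hu.le)
  -- Division by zero yields `0` at `u = 0` and `u = 1`, in agreement with the vanishing of the
  -- numerators nearby.
  refine ⟨β, fun u => β u / u, fun u => (1 - β u) / (1 - u), hβ, ?_, ?_, h1 1 (by norm_num), h0,
    fun u hu => by simp [h0 u hu], fun u => ?_, fun u => ?_⟩
  · refine contDiff_iff_contDiffAt.2 fun u => ?_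
    by_cases hu : u = 0
    · subst hu
      refine (contDiffAt_const (c := (0 : ℝ))).congr_of_eventuallyEq ?_
      have : ∀ᶠ u : ℝ in 𝓝 0, |u| < 1 / 2 :=
        continuous_abs.continuousAt.eventually_lt continuousAt_const (by norm_num)
      filter_upwards [this] with u hu
      simp [h0 u hu]
    · exact hβ.contDiffAt.div contDiffAt_id hu
  · refine contDiff_iff_contDiffAt.2 fun u => ?_
    by_cases hu : u = 1
    · subst hu
      refine (contDiffAt_const (c := (0 : ℝ))).congr_of_eventuallyEq ?_
      have : ∀ᶠ u : ℝ in 𝓝 1, |u - 1| < 1 / 4 :=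
        (by fun_prop : Continuous fun u : ℝ => |u - 1|).continuousAt.eventually_lt
          continuousAt_const (by norm_num)
      filter_upwards [this] with u hu
      simp [h1 u hu]
    · exact (contDiffAt_const.sub hβ.contDiffAt).div (contDiffAt_const.sub contDiffAt_id)
        (sub_ne_zero.2 (Ne.symm hu))
  · by_cases hu : u = 0
    · simp [hu, h0 0 (by norm_num)]
    · field_simp
  · by_cases hu : u = 1
    · simp [hu, h1 1 (by norm_num)]
    · have : 1 - u ≠ 0 := sub_ne_zero.2 (Ne.symm hu)
      field_simp

/-! ### Extension, deformation and restriction along the graph of `1 / f` -/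

section Constructions

variable {V : Type*} [NormedAddCommGroup V] [NormedSpace ℝ V]
variable {M : Type*} [TopologicalSpace M] [ChartedSpace V M]

omit [NormedSpace ℝ V] in
lemma exists_chart_of_mem_atlas_opens {U : TopologicalSpace.Opens M}
    {θ : OpenPartialHomeomorph U V} (hθ : θ ∈ atlas V U) :
    ∃ φ ∈ atlas V M, θ.target ⊆ φ.target ∧ ∀ x ∈ θ.target, ((θ.symm x : U) : M) = φ.symm x := by
  obtain ⟨m, hm⟩ := mem_iUnion.1 hθ
  obtain rfl : θ = (chartAt V (m : M)).subtypeRestr ⟨m⟩ := hm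
  exact ⟨_, chart_mem_atlas V (m : M),
    OpenPartialHomeomorph.subtypeRestr_target_subset _ _,
    fun x hx => OpenPartialHomeomorph.subtypeRestr_symm_apply _ _ hx⟩

variable [IsManifold 𝓘(ℝ, V) ∞ M]

lemma contDiffOn_comp_symm (f : C^∞⟮𝓘(ℝ, V), M; ℝ⟯) {φ : OpenPartialHomeomorph M V}
    (hφ : φ ∈ atlas V M) : ContDiffOn ℝ ∞ (fun x => f (φ.symm x)) φ.target :=
  contMDiffOn_iff_contDiffOn.1 (f.contMDiff.comp_contMDiffOn
    (contMDiffOn_symm_of_mem_maximalAtlas (IsManifold.subset_maximalAtlas hφ)))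

variable {E : Type*} [AddCommGroup E] [Module ℝ E] [TopologicalSpace E] [T2Space E]
  [IsTopologicalAddGroup E] [ContinuousSMul ℝ E] [LocallyConvexSpace ℝ E]
variable (f : C^∞⟮𝓘(ℝ, V), M; ℝ⟯)

omit [IsManifold 𝓘(ℝ, V) ∞ M] in
lemma isOpen_target_inter_ne {φ : OpenPartialHomeomorph M V} :
    IsOpen {x | x ∈ φ.target ∧ f (φ.symm x) ≠ 0} :=
  φ.isOpen_inter_preimage_symm (nonvanishingLocus f).2

omit [IsManifold 𝓘(ℝ, V) ∞ M] [IsTopologicalAddGroup E] [ContinuousSMul ℝ E]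
  [LocallyConvexSpace ℝ E] in
/-- Functions supported away from the zeros of `f` are smooth if they are smooth on `M_f`. -/
lemma jointlySmooth_of_support {Y P : Type*} [TopologicalSpace Y] [NormedAddCommGroup P]
    [NormedSpace ℝ P] {k : Y → P → M → E} {τ : P → ℝ} (hτ : Continuous τ)
    (h0 : ∀ y p m, |τ p * f m| < 1 / 2 → k y p m = 0)
    (h : ∀ φ ∈ atlas V M, SmoothFamOn (fun y (p : P × V) => k y p.1 (φ.symm p.2))
      (univ ×ˢ (univ ×ˢ {x | x ∈ φ.target ∧ f (φ.symm x) ≠ 0}))) :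
    SmoothMap.JointlySmooth V k := by
  refine fun φ hφ => SmoothFamOn.of_locally fun q hq => ?_
  -- Near a zero of `f` the product `τ f` stays small, so `k` vanishes on a whole neighbourhood.
  by_cases hf : f (φ.symm q.2.2) = 0
  · have hcont : ContinuousOn (fun q : Y × (P × V) => |τ q.2.1 * f (φ.symm q.2.2)|)
        (univ ×ˢ (univ ×ˢ φ.target)) := by
      refine (ContinuousOn.mul (by fun_prop) ?_).abs
      exact (f.contMDiff.continuous.comp_continuousOn φ.continuousOn_symm).comp
        (f := fun q : Y × (P × V) => q.2.2) (by fun_prop) fun q hq => hq.2.2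
    have ho := hcont.isOpen_inter_preimage (isOpen_univ.prod (isOpen_univ.prod φ.open_target))
      (isOpen_Iio (a := (1 / 2 : ℝ)))
    refine ⟨_, ho, ⟨hq, by simp [hf]⟩, (SmoothFamOn.zero ho).congr ho fun q hq => ?_⟩
    exact h0 _ _ _ hq.2
  · exact ⟨_, isOpen_univ.prod (isOpen_univ.prod (isOpen_target_inter_ne f)),
      ⟨mem_univ _, mem_univ _, hq.2.2, hf⟩, h φ hφ⟩

open Classical in
/-- The function `(t, m) ↦ w(t f(m)) g(m)`, for a function `g` on `M_f`. -/
noncomputable def extendFun (w : ℝ → ℝ) (g : SmoothMap V (nonvanishingLocus f) E) (t : ℝ) (m : M) :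
    E := if h : f m ≠ 0 then w (t * f m) • g ⟨m, h⟩ else 0

open Classical in
/-- The function `(s, t, m) ↦ w(t f(m)) F(t + s (1 / f(m) - t))(m)`, which deforms `F(t)(m)` into
`F(1 / f(m))(m)`. -/
noncomputable def deformFun (w : ℝ → ℝ) (F : SmoothMap ℝ ℝ (SmoothMap V M E)) (p : ℝ × ℝ) (m : M) :
    E := if f m ≠ 0 then w (p.2 * f m) • F (p.2 + p.1 * (1 / f m - p.2)) m else 0

variable {w : ℝ → ℝ} (hw : ContDiff ℝ ∞ w) (hw0 : ∀ u, |u| < 1 / 2 → w u = 0)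
variable [FiniteDimensional ℝ V]

include hw hw0

/-- On `M_f` this is a pullback, along a chart transition, of the tautological family of local
representatives of `g`, times `w(t f)`. With `g` as parameter, continuity in `g` comes along. -/
theorem jointlySmooth_extendFun : SmoothMap.JointlySmooth V (extendFun (E := E) f w) := by
  refine jointlySmooth_of_support f (τ := id) continuous_id ?_ fun φ hφ => ?_
  · intro g t m (h : |t * f m| < 1 / 2)
    simp only [extendFun]
    split_ifs
    · rw [hw0 _ h, zero_smul]
    · rfl
  refine SmoothFamOn.of_locally fun q hq => ?_
  let m₀ : nonvanishingLocus f := ⟨φ.symm q.2.2, hq.2.2.2⟩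
  let φ₀ := chartAt V (m₀ : M)
  let θ := chartAt V m₀
  have hsrc : ∀ x, x ∈ (φ.symm.trans φ₀).source ↔ x ∈ φ.target ∧ φ.symm x ∈ φ₀.source := by
    intro x
    simp
  have hW := (φ.symm.trans φ₀).open_source.inter (isOpen_target_inter_ne f (φ := φ))
  have hWu := (isOpen_univ (X := ℝ)).prod hW
  have ho := (isOpen_univ (X := SmoothMap V (nonvanishingLocus f) E)).prod hWu
  refine ⟨_, ho, ⟨mem_univ _, mem_univ _, (hsrc _).2 ⟨hq.2.2.1, mem_chart_source V (m₀ : M)⟩,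
    hq.2.2⟩, ?_⟩
  have hsource : ∀ n : nonvanishingLocus f, (n : M) ∈ φ₀.source → n ∈ θ.source := by
    intro n hn
    change n ∈ ((chartAt V (m₀ : M)).subtypeRestr ⟨m₀⟩).source
    rw [OpenPartialHomeomorph.subtypeRestr_source]
    exact hn
  have hcoe : ∀ n : nonvanishingLocus f, θ n = φ₀ n := fun n => rfl
  refine ((SmoothMap.smoothFamOn (E := E) (chart_mem_atlas V m₀)).smul_comp
    (isOpen_univ.prod θ.open_target) hWu (ψ := fun p : ℝ × V => φ₀ (φ.symm p.2))
    (c := fun p : ℝ × V => w (p.1 * f (φ.symm p.2))) ?_ ?_ ho ?_).congr ho ?_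
  · exact (SmoothMap.contDiffOn_transition hφ (chart_mem_atlas V _)).comp contDiffOn_snd
      fun p hp => hp.2.1
  · exact hw.comp_contDiffOn (contDiffOn_fst.mul
      ((contDiffOn_comp_symm f hφ).comp contDiffOn_snd fun p hp => hp.2.2.1))
  · intro r hr
    refine ⟨hr.2, mem_univ _, ?_⟩
    exact θ.map_source (hsource ⟨φ.symm r.2.2, hr.2.2.2.2⟩ ((hsrc _).1 hr.2.2.1).2)
  · intro r hr
    have hne : f (φ.symm r.2.2) ≠ 0 := hr.2.2.2.2
    have hinv := θ.left_inv (hsource ⟨φ.symm r.2.2, hne⟩ ((hsrc _).1 hr.2.2.1).2)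
    rw [hcoe] at hinv
    simp only [extendFun, dif_pos hne]
    rw [hinv]

/-- On `M_f` this is `F`, read on `ℝ × M`, pulled back along `(s, t, x) ↦ (t + s (1/f - t), x)`.
Treating `(s, t)` jointly lets the exponential law be applied twice. -/
theorem jointlySmooth_deformFun : SmoothMap.JointlySmooth V (deformFun (E := E) f w) := by
  refine jointlySmooth_of_support f (τ := Prod.snd) continuous_snd ?_ fun φ hφ => ?_
  · intro F p m h
    simp only [deformFun]
    split_ifs
    · rw [hw0 _ h, zero_smul]
    · rfl
  have hW := (isOpen_univ (X := ℝ × ℝ)).prod (isOpen_target_inter_ne f (φ := φ))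
  have ho := (isOpen_univ (X := SmoothMap ℝ ℝ (SmoothMap V M E))).prod hW
  have hf : ContDiffOn ℝ ∞ (fun p : (ℝ × ℝ) × V => f (φ.symm p.2))
      (univ ×ˢ {x | x ∈ φ.target ∧ f (φ.symm x) ≠ 0}) :=
    (contDiffOn_comp_symm f hφ).comp contDiffOn_snd fun p hp => hp.2.1
  have hs : ContDiff ℝ ∞ fun p : (ℝ × ℝ) × V => p.1.1 := contDiff_fst.comp contDiff_fst
  have ht : ContDiff ℝ ∞ fun p : (ℝ × ℝ) × V => p.1.2 := contDiff_snd.comp contDiff_fst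
  refine ((SmoothMap.jointlySmooth_uncurry φ hφ).smul_comp
    (isOpen_univ.prod (isOpen_univ.prod φ.open_target)) hW
    (ψ := fun p : (ℝ × ℝ) × V => (p.1.2 + p.1.1 * (1 / f (φ.symm p.2) - p.1.2), p.2))
    (c := fun p : (ℝ × ℝ) × V => w (p.1.2 * f (φ.symm p.2))) ?_ ?_ ho ?_).congr ho ?_
  · exact ContDiffOn.prodMk (ht.contDiffOn.add (hs.contDiffOn.mul
      ((contDiffOn_const.div hf fun p hp => hp.2.2).sub ht.contDiffOn))) contDiffOn_snd
  · exact hw.comp_contDiffOn (ht.contDiffOn.mul hf)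
  · exact fun r hr => ⟨hr.2, mem_univ _, mem_univ _, hr.2.2.1⟩
  · intro r hr
    have hne : f (φ.symm r.2.2) ≠ 0 := hr.2.2.2
    simp only [deformFun, if_pos hne]

omit hw hw0

theorem jointlySmooth_smul {c : ℝ × ℝ → ℝ} (hc : ContDiff ℝ ∞ c) :
    SmoothMap.JointlySmooth V
      fun (F : SmoothMap ℝ ℝ (SmoothMap V M E)) (t : ℝ) (m : M) => c (t, f m) • F t m := by
  intro φ hφ
  have hW := (isOpen_univ (X := ℝ)).prod φ.open_target
  have ho := (isOpen_univ (X := SmoothMap ℝ ℝ (SmoothMap V M E))).prod hW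
  exact (SmoothMap.jointlySmooth_uncurry φ hφ).smul_comp ho hW (ψ := fun p => p)
    (c := fun p : ℝ × V => c (p.1, f (φ.symm p.2))) contDiffOn_id
    (hc.comp_contDiffOn (contDiffOn_fst.prodMk
      ((contDiffOn_comp_symm f hφ).comp contDiffOn_snd fun p hp => hp.2))) ho
    fun r hr => ⟨hr.2, hr⟩

theorem smoothFamOn_evalInv {θ : OpenPartialHomeomorph (nonvanishingLocus f) V}
    (hθ : θ ∈ atlas V (nonvanishingLocus f)) :
    SmoothFamOn (fun (F : SmoothMap ℝ ℝ (SmoothMap V M E)) x =>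
      F (1 / f (θ.symm x : nonvanishingLocus f)) (θ.symm x : nonvanishingLocus f))
      (univ ×ˢ θ.target) := by
  obtain ⟨φ, hφ, hsub, hsymm⟩ := exists_chart_of_mem_atlas_opens hθ
  have ho := (isOpen_univ (X := SmoothMap ℝ ℝ (SmoothMap V M E))).prod θ.open_target
  have hne : ∀ x ∈ θ.target, f (φ.symm x) ≠ 0 := by
    intro x hx
    rw [← hsymm x hx]
    exact (θ.symm x).2
  refine ((SmoothMap.jointlySmooth_uncurry φ hφ).comp
    (isOpen_univ.prod (isOpen_univ.prod φ.open_target)) θ.open_target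
    (ψ := fun x => (1 / f (φ.symm x), x)) ?_ ho ?_).congr ho ?_
  · exact (contDiffOn_const.div ((contDiffOn_comp_symm f hφ).mono hsub) hne).prodMk contDiffOn_id
  · exact fun r hr => ⟨hr.2, mem_univ _, mem_univ _, hsub hr.2⟩
  · intro r hr
    simp only [hsymm r.2 hr.2]

/-- The function `m ↦ F(1 / f(m))(m)` on `M_f`. -/
noncomputable def evalInv (F : SmoothMap ℝ ℝ (SmoothMap V M E)) :
    SmoothMap V (nonvanishingLocus f) E where
  toFun m := F (1 / f (m : M)) (m : M)
  smooth _ hθ := (smoothFamOn_evalInv f hθ).smoothOn F fun _ hx => ⟨mem_univ _, hx⟩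

@[simp] lemma evalInv_apply (F : SmoothMap ℝ ℝ (SmoothMap V M E)) (m : nonvanishingLocus f) :
    evalInv f F m = F (1 / f (m : M)) (m : M) := rfl

lemma continuous_evalInv : Continuous (evalInv (E := E) f) :=
  SmoothMap.continuous_of_smoothFamOn fun _θ hθ => smoothFamOn_evalInv f hθ

end Constructions

/-! ### The smooth localization as an algebra of functions -/

section Curves

variable {E : Type*} [AddCommGroup E] [Module ℝ E] [TopologicalSpace E]

lemma refl_mem_atlas_real : OpenPartialHomeomorph.refl ℝ ∈ atlas ℝ ℝ := by simp

/-- The smooth curve given by a function which is smooth on `ℝ`. -/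
def SmoothMap.ofSmoothOn (f : ℝ → E) (hf : SmoothOn f univ) : SmoothMap ℝ ℝ E where
  toFun := f
  smooth φ hφ := by
    rw [chartedSpaceSelf_atlas] at hφ
    subst hφ
    exact hf

lemma SmoothMap.smoothOn_univ (F : SmoothMap ℝ ℝ E) : SmoothOn F univ :=
  F.smooth _ refl_mem_atlas_real

lemma SmoothMap.continuous_of_smoothFamOn_univ {Y : Type*} [TopologicalSpace Y]
    {F : Y → SmoothMap ℝ ℝ E} (h : SmoothFamOn (fun y t => F y t) univ) : Continuous F := by
  refine SmoothMap.continuous_of_smoothFamOn fun φ hφ => ?_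
  rw [chartedSpaceSelf_atlas] at hφ
  subst hφ
  exact h.mono (subset_univ _)

/-- The derivative of a smooth curve. -/
noncomputable def SmoothMap.derivative (F : SmoothMap ℝ ℝ E) : SmoothMap ℝ ℝ E :=
  .ofSmoothOn (dirDeriv F 1) fun vs => by
    have : iterDeriv (dirDeriv F 1) vs = iterDeriv F (vs ++ [1]) := by
      rw [iterDeriv_append]
      rfl
    rw [this]
    exact F.smoothOn_univ (vs ++ [1])

end Curves

section Localization

variable {V : Type*} [NormedAddCommGroup V] [NormedSpace ℝ V] [FiniteDimensional ℝ V]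
variable {M : Type*} [TopologicalSpace M] [ChartedSpace V M] [IsManifold 𝓘(ℝ, V) ∞ M]
variable {A : Type*} [Ring A] [Algebra ℝ A] [TopologicalSpace A] [LocallyConvexAlgebra A]
variable (f : C^∞⟮𝓘(ℝ, V), M; ℝ⟯)

lemma localizer_ofReal_apply (t : ℝ) (m : M) :
    localizer (SmoothMap.ofReal A f) t m = (1 - t * f m) • (1 : A) := by
  change ((1 : SmoothMap V M A) - t • SmoothMap.ofReal A f) m = _
  simp [sub_smul, mul_smul]

lemma localizer_mul_mem {B : Type*} [Ring B] [Algebra ℝ B] [TopologicalSpace B]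
    [LocallyConvexAlgebra B] (a : B) (G : SmoothMap ℝ ℝ B) :
    localizer a * G ∈ localizationIdeal a :=
  subset_closure ((TwoSidedIdeal.span {localizer a}).mul_mem_right _ _
    (TwoSidedIdeal.subset_span rfl))

/-- The kernel of `Ψ` is a two-sided ideal, closed because `C` is Hausdorff. -/
lemma localizationIdeal_le {B : Type*} [Ring B] [Algebra ℝ B] [TopologicalSpace B]
    [LocallyConvexAlgebra B] (a : B) {C : Type*} [Ring C] [TopologicalSpace C] [T2Space C]
    (Ψ : SmoothMap ℝ ℝ B →+* C) (hΨ : Continuous Ψ) (ha : Ψ (localizer a) = 0)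
    {F : SmoothMap ℝ ℝ B} (hF : F ∈ localizationIdeal a) : Ψ F = 0 := by
  have h : TwoSidedIdeal.span {localizer a} ≤ TwoSidedIdeal.ker Ψ :=
    TwoSidedIdeal.span_le.2 (singleton_subset_iff.2 ((TwoSidedIdeal.mem_ker Ψ).2 ha))
  exact closure_minimal (s := {G | G ∈ TwoSidedIdeal.span {localizer a}}) (t := Ψ ⁻¹' {0})
    (fun G hG => (TwoSidedIdeal.mem_ker Ψ).1 (h hG))
    (isClosed_singleton.preimage hΨ) hF

/-- A smooth function on `ℝ × M` whose restriction to the graph of `1 / f` vanishes belongs to the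
closed ideal generated by `1 - t f`. -/
theorem mem_localizationIdeal_of_evalInv_eq_zero {F : SmoothMap ℝ ℝ (SmoothMap V M A)}
    (hF : evalInv f F = 0) : F ∈ localizationIdeal (SmoothMap.ofReal A f) := by
  obtain ⟨χ, w, ρ, hχ, hw, hρ, -, hχ0, hw0, hχw, hχρ⟩ := exists_cutoff
  let I := localizationIdeal (SmoothMap.ofReal A f)
  have hK := jointlySmooth_deformFun (E := A) f hχ hχ0
  -- A second use of the exponential law, now with `t ∈ ℝ` as manifold variable, makes `s ↦ K_s` a
  -- smooth curve in `C^∞(ℝ, C^∞(M, A))`.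
  have hκ : SmoothMap.JointlySmooth ℝ fun (F : SmoothMap ℝ ℝ (SmoothMap V M A)) (s t : ℝ) =>
      hK.curry F (s, t) := by
    intro φ hφ
    rw [chartedSpaceSelf_atlas] at hφ
    subst hφ
    exact hK.smoothFamOn.mono (subset_univ _)
  have hL := jointlySmooth_deformFun (E := A) f hw hw0
  have hder : ∀ s, (hκ.dirDeriv 1).curry F s ∈ I := by
    intro s
    have hsmul := jointlySmooth_smul (V := V) (E := A) f (c := Prod.fst) contDiff_fst
    -- the curve `t ↦ (m ↦ w(t f(m)) F'(t + s (1 / f(m) - t))(m))`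
    let L₀ : SmoothMap ℝ ℝ (SmoothMap V M A) := .ofSmoothOn
      (fun t => hL.curry F.derivative (s, t))
      (hL.smoothFamOn.slice.smoothOn (F.derivative, s) fun _ _ => mem_univ _)
    -- The extra factor `t` comes from `χ(t f) (1/f - t) = (1 - t f) t w(t f)`.
    let L : SmoothMap ℝ ℝ (SmoothMap V M A) := .ofSmoothOn (hsmul.curry L₀)
      (hsmul.smoothFamOn.smoothOn L₀ fun _ _ => mem_univ _)
    have heq : (hκ.dirDeriv 1).curry F s = localizer (SmoothMap.ofReal A f) * L := by
      ext t m
      have h1 : Tendsto (fun τ => diffQuot (fun s => deformFun f χ F (s, t) m) 1 s τ) (𝓝[≠] 0)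
          (𝓝 ((hκ.dirDeriv 1).curry F s t m)) := by
        have h2 := hκ.tendsto_diffQuot 1 F s
        have h3 : Continuous fun G : SmoothMap ℝ ℝ (SmoothMap V M A) => G t m :=
          (SmoothMap.continuous_eval m).comp (SmoothMap.continuous_eval t)
        refine ((h3.tendsto _).comp h2).congr fun τ => ?_
        simp only [diffQuot, Function.comp_apply, SmoothMap.smul_apply, SmoothMap.sub_apply,
          smul_eq_mul, mul_one]
        rfl
      refine tendsto_nhds_unique h1 ?_
      rw [SmoothMap.mul_apply, SmoothMap.mul_apply, localizer_ofReal_apply]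
      change Tendsto _ _ (𝓝 ((1 - t * f m) • (1 : A) * (t • deformFun f w F.derivative (s, t) m)))
      by_cases hm : f m ≠ 0
      · simp only [deformFun, if_pos hm]
        let u := 1 / f m - t
        let b : Module.Basis Unit ℝ ℝ := Module.Basis.singleton Unit ℝ
        have hFm : ∀ z : ℝ, Tendsto (diffQuot (fun t => F t m) 1 z) (𝓝[≠] 0)
            (𝓝 (F.derivative z m)) := by
          intro z
          have h2 := F.smoothOn_univ.tendsto [] 1 (mem_univ z)
          refine (((SmoothMap.continuous_eval m).tendsto _).comp h2).congr fun τ => ?_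
          simp [diffQuot, iterDeriv]
        have hslope : Tendsto (fun τ : ℝ => τ⁻¹ • ((t + (s + τ * 1) * u) - (t + s * u))) (𝓝[≠] 0)
            (𝓝 u) := by
          refine (tendsto_const_nhds (x := u)).congr' ?_
          filter_upwards [self_mem_nhdsWithin] with τ hτ
          have hτ : τ ≠ 0 := hτ
          simp only [smul_eq_mul]
          field_simp
          ring
        have hcomp := tendsto_comp_of_partial b (g := fun t => F t m)
          (g' := fun _ z => F.derivative z m) isOpen_univ (mem_univ (t + s * u))
          (fun _ => ((SmoothMap.continuous_eval m).comp
            (continuousOn_univ.1 (F.derivative.smoothOn_univ []).1)).continuousAt)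
          (fun i z _ => by simpa [b] using hFm z) hslope
        have hfin := hcomp.const_smul (χ (t * f m))
        have hval : χ (t * f m) • ∑ i, b.repr u i • F.derivative (t + s * u) m =
            (1 - t * f m) • (1 : A) *
              (t • w (t * f m) • F.derivative (t + s * (1 / f m - t)) m) := by
          simp only [b, Finset.univ_unique, Finset.sum_singleton, Module.Basis.singleton_repr]
          rw [smul_one_mul, smul_smul, smul_smul, smul_smul, hχw]
          congr 1
          simp only [u]
          field_simp
        rw [hval] at hfin
        refine hfin.congr fun τ => ?_
        simp only [diffQuot, smul_sub, smul_eq_mul, u]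
        rw [smul_comm, smul_comm (χ (t * f m)) τ⁻¹ (F (t + s * _) m)]
      · simp only [deformFun, if_neg hm, diffQuot_const, smul_zero, mul_zero]
        exact tendsto_const_nhds
    rw [heq]
    exact localizer_mul_mem _ _
  have hIconv : Convex ℝ (I : Set (SmoothMap ℝ ℝ (SmoothMap V M A))) :=
    (I.restrictScalars ℝ).convex
  -- Integration over `s` is replaced by the mean value theorem with the closed convex set `I`.
  have h10 : hκ.curry F 1 - hκ.curry F 0 ∈ I :=
    hIconv.sub_mem_of_diffQuot isClosed_closure (fun s _ => hκ.tendsto_diffQuot 1 F s)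
      fun s _ => hder s
  have hone : hκ.curry F 1 = 0 := by
    ext t m
    change deformFun f χ F (1, t) m = 0
    simp only [deformFun]
    split_ifs with hm
    · have := DFunLike.congr_fun hF ⟨m, hm⟩
      rw [evalInv_apply, SmoothMap.zero_apply] at this
      rw [one_mul, add_sub_cancel, this, smul_zero]
    · rfl
  have hzero : F - hκ.curry F 0 ∈ I := by
    have hsmul := jointlySmooth_smul (V := V) (E := A) f (c := fun p => ρ (p.1 * p.2))
      (hρ.comp (contDiff_fst.mul contDiff_snd))
    let R : SmoothMap ℝ ℝ (SmoothMap V M A) := .ofSmoothOn (hsmul.curry F)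
      (hsmul.smoothFamOn.smoothOn F fun _ _ => mem_univ _)
    have heq : F - hκ.curry F 0 = localizer (SmoothMap.ofReal A f) * R := by
      ext t m
      rw [SmoothMap.mul_apply, SmoothMap.mul_apply, localizer_ofReal_apply, SmoothMap.sub_apply,
        SmoothMap.sub_apply]
      change F t m - deformFun f χ F (0, t) m =
        (1 - t * f m) • (1 : A) * (ρ (t * f m) • F t m)
      -- At zeros of `f` the value `0` in `deformFun` is correct because `χ 0 = 0`.
      have h0 : deformFun f χ F (0, t) m = χ (t * f m) • F t m := by
        simp only [deformFun]
        split_ifs with hm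
        · rw [zero_mul, add_zero]
        · rw [not_not] at hm
          rw [hm, mul_zero, hχ0 0 (by norm_num), zero_smul]
      rw [h0, smul_one_mul, smul_smul, ← hχρ, sub_smul, one_smul]
    rw [heq]
    exact localizer_mul_mem _ _
  rw [hone, zero_sub] at h10
  have := I.add_mem hzero (I.neg_mem h10)
  simpa using this

theorem exists_continuous_rightInverse_evalInv :
    ∃ σ : SmoothMap V (nonvanishingLocus f) A → SmoothMap ℝ ℝ (SmoothMap V M A),
      Continuous σ ∧ ∀ g, evalInv f (σ g) = g := by
  obtain ⟨χ, -, -, hχ, -, -, hχ1, hχ0, -⟩ := exists_cutoff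
  have hk := jointlySmooth_extendFun (E := A) f hχ hχ0
  refine ⟨fun g => .ofSmoothOn (hk.curry g) (hk.smoothFamOn.smoothOn g fun _ _ => mem_univ _),
    SmoothMap.continuous_of_smoothFamOn_univ hk.smoothFamOn, fun g => ?_⟩
  ext m
  have hm : f (m : M) ≠ 0 := m.2
  change extendFun f χ g (1 / f (m : M)) (m : M) = g m
  simp only [extendFun, dif_pos hm]
  rw [one_div_mul_cancel hm, hχ1, one_smul]

variable (𝕜 : Type*) [RCLike 𝕜] [Algebra 𝕜 A] [IsScalarTower ℝ 𝕜 A]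

/-- The evaluation `F ↦ (m ↦ F(1 / f(m))(m))` as a homomorphism of algebras. -/
noncomputable def evalInvAlgHom :
    SmoothMap ℝ ℝ (SmoothMap V M A) →ₐ[𝕜] SmoothMap V (nonvanishingLocus f) A :=
  { toFun := evalInv f
    map_one' := rfl
    map_mul' := fun _ _ => rfl
    map_zero' := rfl
    map_add' := fun _ _ => rfl
    commutes' := fun c => by
      rw [Algebra.algebraMap_eq_smul_one, Algebra.algebraMap_eq_smul_one]
      rfl }

/-- The inverse is the class of the section `σ`: the element `σ (evalInv f F) - F` is killed by
`evalInv`, hence lies in the ideal. Continuity of `σ` gives that of the inverse. -/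
theorem exists_localization_equiv :
    ∃ φ : SmoothLocalization (SmoothMap.ofReal A f) ≃A[𝕜] SmoothMap V (nonvanishingLocus f) A,
      ∀ (F : SmoothMap ℝ ℝ (SmoothMap V M A)) (m : nonvanishingLocus f),
        φ (SmoothLocalization.mk (SmoothMap.ofReal A f) F) m = F (1 / f (m : M)) (m : M) := by
  obtain ⟨σ, hσ, hσr⟩ := exists_continuous_rightInverse_evalInv (A := A) f
  let Ψ := evalInvAlgHom (A := A) f 𝕜
  have hΨc : Continuous Ψ := continuous_evalInv f
  have hΨ : ∀ F ∈ localizationIdeal (SmoothMap.ofReal A f), Ψ F = 0 := by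
    intro F hF
    refine localizationIdeal_le _ Ψ.toRingHom hΨc ?_ hF
    ext m
    have hm : f (m : M) ≠ 0 := m.2
    change localizer (SmoothMap.ofReal A f) (1 / f (m : M)) (m : M) = 0
    rw [localizer_ofReal_apply, one_div_mul_cancel hm, sub_self, zero_smul]
  let φ := Ideal.Quotient.liftₐ (localizationIdeal (SmoothMap.ofReal A f)) Ψ hΨ
  have hφ : ∀ F, φ (SmoothLocalization.mk (SmoothMap.ofReal A f) F) = evalInv f F := fun F => rfl
  have hq := SmoothLocalization.isOpenQuotientMap_mk (SmoothMap.ofReal A f)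
  refine ⟨{ φ with
    invFun := fun g => SmoothLocalization.mk (SmoothMap.ofReal A f) (σ g)
    left_inv := ?_
    right_inv := fun g => (hφ _).trans (hσr g)
    continuous_toFun := hq.isQuotientMap.continuous_iff.2 hΨc
    continuous_invFun := hq.continuous.comp hσ }, fun F m => rfl⟩
  intro x
  obtain ⟨F, rfl⟩ := hq.surjective x
  change SmoothLocalization.mk _ (σ (evalInv f F)) = SmoothLocalization.mk _ F
  refine Ideal.Quotient.eq.2 (mem_localizationIdeal_of_evalInv_eq_zero f ?_)
  have h : Ψ (σ (evalInv f F) - F) = 0 := by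
    rw [map_sub, sub_eq_zero]
    exact hσr (evalInv f F)
  exact h

end Localization

/-- An additive homeomorphism is uniform for the group uniformities, so completeness transfers along
with metrizability. -/
theorem FrechetAlgebra.of_equiv {A B : Type*} [Ring A] [Algebra ℝ A] [TopologicalSpace A]
    [LocallyConvexAlgebra A] [Ring B] [Algebra ℝ B] [TopologicalSpace B] [FrechetAlgebra B]
    (e : A ≃A[ℝ] B) : FrechetAlgebra A where
  metrizable :=
    have := FrechetAlgebra.metrizable (A := B)
    e.toHomeomorph.isEmbedding.metrizableSpace
  complete := by
    let _ : UniformSpace A := IsTopologicalAddGroup.rightUniformSpace A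
    let _ : UniformSpace B := IsTopologicalAddGroup.rightUniformSpace B
    have : IsUniformAddGroup A := isUniformAddGroup_of_addCommGroup
    have : IsUniformAddGroup B := isUniformAddGroup_of_addCommGroup
    have : CompleteSpace B := FrechetAlgebra.complete
    have h := AddMonoidHom.isUniformInducing_of_isInducing (f := e) e.toHomeomorph.isInducing
    exact (h.completeSpace_congr e.surjective).2 inferInstance

theorem corollaryC {𝕜 : Type*} [RCLike 𝕜]
    {V : Type*} [NormedAddCommGroup V] [NormedSpace ℝ V] [FiniteDimensional ℝ V]
    {M : Type*} [TopologicalSpace M] [T2Space M] [SecondCountableTopology M]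
    [ChartedSpace V M] [IsManifold 𝓘(ℝ, V) ∞ M]
    {A : Type*} [Ring A] [Algebra ℝ A] [Algebra 𝕜 A] [IsScalarTower ℝ 𝕜 A]
    [TopologicalSpace A] [FrechetAlgebra A] [ContinuousSMul 𝕜 A] :
    (∀ f : C^∞⟮𝓘(ℝ, V), M; ℝ⟯,
      FrechetAlgebra (SmoothLocalization (SmoothMap.ofReal A f)) ∧
      FrechetAlgebra (SmoothMap V (nonvanishingLocus f) A) ∧
      ∃ φ : SmoothLocalization (SmoothMap.ofReal A f) ≃A[𝕜] SmoothMap V (nonvanishingLocus f) A,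
        ∀ (F : SmoothMap ℝ ℝ (SmoothMap V M A)) (m : nonvanishingLocus f),
          φ (SmoothLocalization.mk (SmoothMap.ofReal A f) F) m = F (1 / f (m : M)) (m : M)) ∧
    (∀ U : TopologicalSpace.Opens M,
      (∃ f : C^∞⟮𝓘(ℝ, V), M; ℝ⟯, nonvanishingLocus f = U) ∧
      FrechetAlgebra (SmoothMap V U A) ∧
      ∀ f : C^∞⟮𝓘(ℝ, V), M; ℝ⟯, nonvanishingLocus f = U →
        ∃ φ : SmoothLocalization (SmoothMap.ofReal A f) ≃A[𝕜] SmoothMap V U A,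
          ∀ (F : SmoothMap ℝ ℝ (SmoothMap V M A)) (m : U),
            φ (SmoothLocalization.mk (SmoothMap.ofReal A f) F) m =
              F (1 / f (m : M)) (m : M)) := by
  have hFr : ∀ (U : TopologicalSpace.Opens M), FrechetAlgebra (SmoothMap V U A) :=
    fun _ => SmoothMap.frechetAlgebra
  refine ⟨fun f => ⟨?_, hFr _, exists_localization_equiv f 𝕜⟩, fun U => ⟨?_, hFr U, ?_⟩⟩
  · have := hFr (nonvanishingLocus f)
    exact .of_equiv (exists_localization_equiv (A := A) f ℝ).choose
  · have : ProperSpace V := FiniteDimensional.proper ℝ V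
    have : LocallyCompactSpace M := ChartedSpace.locallyCompactSpace V M
    -- Every open subset of `M` is exactly the support, in the sense of the nonvanishing set, of
    -- some smooth function.
    obtain ⟨f, hf, hfs, -⟩ := U.2.exists_contMDiff_support_eq 𝓘(ℝ, V) (M := M)
    exact ⟨⟨f, hfs⟩, TopologicalSpace.Opens.ext hf⟩
  · rintro f rfl
    exact exists_localization_equiv f 𝕜
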